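/- Let $H$ be a hyperplane of $PG(6,2)$ and let $\pi$ be a polarity of $H\cong PG(5,2)$, i.e. an inclusion-reversing involution on the set of subspaces of $H$. Let $D$ be the polarity design obtained from $PG(6,2)$: its points are the $127$ points of $PG(6,2)$, and its blocks are the $3$-dimensional (projective dimension) subspaces $W$ of $PG(6,2)$ contained in $H$, together with the sets $(W\setminus H)\cup\pi(W\cap H)$ for the $3$-dimensional subspaces $W$ of $PG(6,2)$ not contained in $H$. Then $D$ is a $2$-$(127,15,155)$ design. Let $C\subseteq GF(2)^{127}$ be the binary linear code spanned by the incidence vectors of the blocks of $D$, and let $C^*$ be its extended code, obtained by appending an overall parity check to each codeword. Then $C^*$ is a doubly-even self-dual $[128,64,16]$ code, and its weight distribution is identical to that of the third-order Reed–Muller code $R(3,7)$ of length $128$: for every $i$, the two codes have the same number $A_i$ of codewords of weight $i$. In particular $A_{16}=94488$ and $A_{20}=0$. -/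

import Mathlib

open scoped LinearAlgebra.Projectivization

/-! ### Designs -/

/-- The set system `𝓑` of blocks on the point set `P` is a `2-(v, k, l)` design: there are `v` points,
each block has `k` points, and any two distinct points lie together in exactly `l` blocks. -/
def IsTwoDesign {P : Type*} (𝓑 : Set (Set P)) (v k l : ℕ) : Prop :=
  Nat.card P = v ∧ (∀ B ∈ 𝓑, B.ncard = k) ∧
    ∀ p q : P, p ≠ q → {B ∈ 𝓑 | p ∈ B ∧ q ∈ B}.ncard = l

section Polarity

variable {K V : Type*} [Field K] [AddCommGroup V] [Module K V]

/-- A polarity of the projective space of `U`: an inclusion-reversing involution on the subspaces. -/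
def IsPolarity {U : Type*} [AddCommGroup U] [Module K U] (π : Submodule K U → Submodule K U) :
    Prop :=
  Antitone π ∧ Function.Involutive π

/-- The set of points of the projective subspace given by the linear subspace `W`. -/
def projPoints (W : Submodule K V) : Set (ℙ K V) := (W.projectivization : Set (ℙ K V))

/-- The blocks of the polarity design on the points of `ℙ K V`, for a hyperplane `H`, a polarity `π`
of `H`, and subspaces of projective dimension `s` (so of linear dimension `s + 1`).
An `s`-subspace `W` contained in `H` stays a block;
one not contained in `H` is replaced by `(W \ H) ∪ π (W ∩ H)`. -/
def polarityBlocks (s : ℕ) (H : Submodule K V) (π : Submodule K H → Submodule K H) :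
    Set (Set (ℙ K V)) :=
  {B | ∃ W : Submodule K V, Module.finrank K W = s + 1 ∧ W ≤ H ∧ B = projPoints W} ∪
  {B | ∃ W : Submodule K V, Module.finrank K W = s + 1 ∧ ¬ W ≤ H ∧
    B = (projPoints W \ projPoints H) ∪ projPoints ((π (W.submoduleOf H)).map H.subtype)}

noncomputable instance instFintypeProjectivization [Finite V] : Fintype (ℙ K V) :=
  Fintype.ofFinite _

end Polarity

/-! ### Binary linear codes

A binary linear code with coordinates indexed by `ι` is a linear subspace of `ι → ZMod 2`. -/

section Codes

variable {ι : Type*}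

/-- The binary code spanned by the incidence vectors of the blocks. -/
noncomputable def blockCode (𝓑 : Set (Set ι)) : Submodule (ZMod 2) (ι → ZMod 2) :=
  Submodule.span (ZMod 2) ((fun B : Set ι => B.indicator (1 : ι → ZMod 2)) '' 𝓑)

variable [Fintype ι]

/-- The extended code: append to each codeword an overall parity check, in the coordinate `none`. -/
def extendedCode (C : Submodule (ZMod 2) (ι → ZMod 2)) :
    Submodule (ZMod 2) (Option ι → ZMod 2) where
  carrier := {x | (fun i => x (some i)) ∈ C ∧ ∑ o, x o = 0}
  zero_mem' := ⟨C.zero_mem, by simp⟩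
  add_mem' := fun {x y} hx hy => ⟨C.add_mem hx.1 hy.1, by
    simp only [Pi.add_apply, Finset.sum_add_distrib, hx.2, hy.2, add_zero]⟩
  smul_mem' := fun a x hx => ⟨C.smul_mem a hx.1, by
    simp only [Pi.smul_apply, ← Finset.smul_sum, hx.2, smul_zero]⟩

/-- The dual code. -/
def dualCode (C : Submodule (ZMod 2) (ι → ZMod 2)) : Submodule (ZMod 2) (ι → ZMod 2) where
  carrier := {x | ∀ c ∈ C, x ⬝ᵥ c = 0}
  zero_mem' := fun c _ => zero_dotProduct c
  add_mem' := fun {x y} hx hy c hc => by rw [add_dotProduct, hx c hc, hy c hc, add_zero]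
  smul_mem' := fun a x hx c hc => by rw [smul_dotProduct, hx c hc, smul_zero]

def IsSelfDual (C : Submodule (ZMod 2) (ι → ZMod 2)) : Prop := dualCode C = C

/-- All codewords have weight divisible by four. -/
def IsDoublyEven (C : Submodule (ZMod 2) (ι → ZMod 2)) : Prop := ∀ c ∈ C, 4 ∣ hammingNorm c

/-- `C` is an `[n, k, d]` code: length `n`, dimension `k`, minimum distance exactly `d`. -/
def HasParameters (C : Submodule (ZMod 2) (ι → ZMod 2)) (n k d : ℕ) : Prop :=
  Fintype.card ι = n ∧ Module.finrank (ZMod 2) C = k ∧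
    IsLeast {r | ∃ x ∈ C, ∃ y ∈ C, x ≠ y ∧ hammingDist x y = r} d

/-- The weight distribution: the number `A i` of codewords of weight `i`. -/
noncomputable def weightDistribution (C : Submodule (ZMod 2) (ι → ZMod 2)) (i : ℕ) : ℕ :=
  {c | c ∈ C ∧ hammingNorm c = i}.ncard

end Codes

/-- The Reed–Muller code `R(r, m)` of order `r` and length `2 ^ m`: the value vectors on `𝔽₂ᵐ` of the
polynomials in `m` variables over `𝔽₂` of total degree at most `r`. -/
noncomputable def reedMuller (r m : ℕ) : Submodule (ZMod 2) ((Fin m → ZMod 2) → ZMod 2) :=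
  (MvPolynomial.restrictTotalDegree (Fin m) (ZMod 2) r).map
    (LinearMap.pi fun x => (MvPolynomial.aeval x).toLinearMap)

/-! ### Affine flats over the binary field and functions even on all flats of a given dimension -/

section Flats

open Module
open scoped Classical

variable {V : Type*} [AddCommGroup V] [Module (ZMod 2) V]

/-! Add the zero vector to the 127 points: the extended point set is the whole space, which is `H`
together with a coset `w + H`, so words become pairs `(a, b)` of functions on the 6-dimensional
space `K = H`. An extended block is either `(W, 0)` with `W` a 4-dimensional subspace of `K`, or `(π
U, x + U)` with `U` of dimension 3. The design parameters are counts of subspaces through points in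
this model.

Let `flatDual V j` be the functions even on every `j`-flat; in dimension `n` this is the Reed–Muller
code of order `j - 1`. Two generators are orthogonal: for pairs of 3-spaces, `π` preserves the
dimension of the meet, so the two halves contribute equally (`IsPolarity.flat_dotProduct_flat`);
otherwise the flats share a direction. All generators have weight 16, so the code is doubly even. If
`(a, b)` is in the dual, then `a` is in `flatDual K 4`, and `b` is in `flatDual K 3` when `a = 0`;
hence the dual has dimension at most 42 + 22 = 64, and the code is self-dual.

For two doubly-even self-dual codes of length 128 the MacWilliams identity forces equal weight
distributions as soon as they agree below weight 24 (`weightDistribution_eq_of_lt`). So only minimum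
weight 16, `A_20 = 0` and `A_16` have to be compared. Induction on hyperplane sections combined with
Parseval's identity gives the minimum weight of `flatDual`, identifies its minimum words as flats,
and excludes weight 10 at minimum weight 8 and weight 20 at minimum weight 16. In the polarity code,
a word of weight 20 with two nonzero halves would have halves of weights 8 and 12; the half of
weight 8 is a flat, and gluing a flat to the other half gives a forbidden word of weight 20 in
`flatDual (K × ZMod 2) 4`. Finally `A_16` is a count of flats in both codes: 2·651·4 + 1395·64 =
11811·8 = 94488. -/

theorem add_self_eq_zero_of_binary (v : V) : v + v = 0 := by
  rw [← two_smul (ZMod 2) v, show (2 : ZMod 2) = 0 from rfl, zero_smul]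

theorem neg_eq_self_of_binary (v : V) : -v = v :=
  neg_eq_of_add_eq_zero_left (add_self_eq_zero_of_binary v)

theorem zmod_two_cases (z : ZMod 2) : z = 0 ∨ z = 1 := by
  revert z; decide

/-- The indicator function of the affine flat `x + U`. -/
noncomputable def flat (U : Submodule (ZMod 2) V) (x : V) : V → ZMod 2 :=
  fun v => if v - x ∈ U then 1 else 0

theorem flat_add_of_mem {U : Submodule (ZMod 2) V} {x u : V} (hu : u ∈ U) (v : V) :
    flat U x (v + u) = flat U x v := by
  have : v + u - x = (v - x) + u := by abel
  simp [flat, this, Submodule.add_mem_iff_left _ hu]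

theorem flat_eq_iff {U : Submodule (ZMod 2) V} {x y : V} :
    flat U x = flat U y ↔ y - x ∈ U := by
  constructor
  · intro h
    have := congrFun h y
    by_contra hn
    rw [flat, flat, if_neg hn, sub_self, if_pos (U.zero_mem)] at this
    exact zero_ne_one this
  · intro h
    funext v
    have : v - x ∈ U ↔ v - y ∈ U := by
      rw [show v - x = (v - y) + (y - x) by abel, Submodule.add_mem_iff_left _ h]
    simp only [flat, this]

theorem flat_inj {U U' : Submodule (ZMod 2) V} {x y : V} (h : flat U x = flat U' y) : U = U' := by
  have hx : x - y ∈ U' := by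
    by_contra hn
    have := congrFun h x
    simp [flat, hn] at this
  have h' : flat U x = flat U' x := h.trans (flat_eq_iff.2 hx)
  ext u
  have := congrFun h' (x + u)
  by_cases h1 : u ∈ U <;> by_cases h2 : u ∈ U' <;> simp_all [flat]

theorem flat_split {U U' : Submodule (ZMod 2) V} {v : V} (hU : U ≤ U') (hv : v ∈ U')
    (hvU : v ∉ U) (hdim : ∀ w ∈ U', w ∈ U ∨ w - v ∈ U) (x : V) :
    flat U' x = flat U x + flat U (x + v) := by
  funext w
  simp only [flat, Pi.add_apply]
  have e : w - (x + v) = w - x - v := by abel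
  rw [e]
  by_cases h : w - x ∈ U'
  · rw [if_pos h]
    rcases hdim _ h with h1 | h1
    · rw [if_pos h1, if_neg, add_zero]
      intro h2
      exact hvU (by simpa using U.sub_mem h1 h2)
    · rw [if_neg, if_pos h1, zero_add]
      intro h2
      exact hvU (by simpa using U.sub_mem h2 h1)
  · rw [if_neg h, if_neg, if_neg, add_zero]
    · intro h1
      exact h (by simpa using U'.add_mem (hU h1) hv)
    · exact fun h1 => h (hU h1)

theorem exists_of_finrank_succ [Finite V] {U U' : Submodule (ZMod 2) V} (hU : U ≤ U')
    (h : finrank (ZMod 2) U' = finrank (ZMod 2) U + 1) :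
    ∃ v ∈ U', v ∉ U ∧ ∀ w ∈ U', w ∈ U ∨ w - v ∈ U := by
  obtain ⟨v, hv, hvU⟩ : ∃ v ∈ U', v ∉ U := by
    by_contra! hcon
    have : U' = U := le_antisymm hcon hU
    rw [this] at h
    omega
  refine ⟨v, hv, hvU, fun w hw => ?_⟩
  have hle : U ⊔ Submodule.span (ZMod 2) {v} ≤ U' :=
    sup_le hU (by simpa using hv)
  have hlt : U < U ⊔ Submodule.span (ZMod 2) {v} := by
    refine lt_of_le_of_ne le_sup_left fun he => hvU ?_
    rw [he]
    exact Submodule.mem_sup_right (Submodule.mem_span_singleton_self v)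
  have h1 := Submodule.finrank_lt_finrank_of_lt hlt
  have h2 : U ⊔ Submodule.span (ZMod 2) {v} = U' :=
    Submodule.eq_of_le_of_finrank_le hle (by omega)
  rw [← h2] at hw
  obtain ⟨u, hu, z, hz, rfl⟩ := Submodule.mem_sup.1 hw
  obtain ⟨c, rfl⟩ := Submodule.mem_span_singleton.1 hz
  rcases zmod_two_cases c with rfl | rfl
  · left; simpa using hu
  · right; simpa using hu

theorem exists_le_finrank [Finite V] {U : Submodule (ZMod 2) V} {k : ℕ}
    (hk : k ≤ finrank (ZMod 2) U) : ∃ U' ≤ U, finrank (ZMod 2) U' = k := by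
  obtain ⟨b, hb⟩ := exists_linearIndependent_of_le_finrank hk
  refine ⟨(Submodule.span (ZMod 2) (Set.range b)).map U.subtype, Submodule.map_subtype_le _ _, ?_⟩
  rw [Submodule.finrank_map_subtype_eq, finrank_span_eq_card hb, Fintype.card_fin]

theorem finrank_sup_span_singleton [Finite V] {U : Submodule (ZMod 2) V} {v : V} (hv : v ∉ U) :
    finrank (ZMod 2) ↥(U ⊔ Submodule.span (ZMod 2) {v}) = finrank (ZMod 2) U + 1 := by
  have hv0 : v ≠ 0 := fun h => hv (h ▸ U.zero_mem)
  have hd : U ⊓ Submodule.span (ZMod 2) {v} = ⊥ := by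
    rw [eq_bot_iff]
    rintro w ⟨hw, hw'⟩
    obtain ⟨c, rfl⟩ := Submodule.mem_span_singleton.1 hw'
    rcases zmod_two_cases c with rfl | rfl
    · simp
    · exact absurd (by simpa using hw) hv
  have := Submodule.finrank_sup_add_finrank_inf_eq U (Submodule.span (ZMod 2) {v})
  rw [hd, finrank_bot, finrank_span_singleton hv0] at this
  omega

theorem mem_sup_span_singleton {U : Submodule (ZMod 2) V} {v w : V} :
    w ∈ U ⊔ Submodule.span (ZMod 2) {v} ↔ w ∈ U ∨ w - v ∈ U := by
  constructor
  · intro hw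
    obtain ⟨u, hu, z, hz, rfl⟩ := Submodule.mem_sup.1 hw
    obtain ⟨c, rfl⟩ := Submodule.mem_span_singleton.1 hz
    rcases zmod_two_cases c with rfl | rfl
    · left; simpa using hu
    · right; simpa using hu
  · rintro (h | h)
    · exact Submodule.mem_sup_left h
    · have := Submodule.add_mem_sup h (Submodule.mem_span_singleton_self (R := ZMod 2) v)
      simpa using this

theorem exists_notMem_of_finrank_lt [Finite V] {U : Submodule (ZMod 2) V}
    (h : finrank (ZMod 2) U < finrank (ZMod 2) V) :
    ∃ v, v ∉ U := by
  by_contra! hcon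
  have : U = ⊤ := eq_top_iff.2 fun w _ => hcon w
  rw [this, finrank_top] at h
  exact lt_irrefl _ h

variable [Fintype V]

theorem sum_eq_zero_of_periodic (f : V → ZMod 2) (v : V) (hv : v ≠ 0)
    (hf : ∀ x, f (x + v) = f x) : ∑ x, f x = 0 := by
  refine Finset.sum_involution (fun x _ => x + v) ?_ ?_ ?_ ?_
  · intro x _
    rw [hf]
    exact add_self_eq_zero_of_binary (f x)
  · intro x _ _ h
    exact hv (by simpa using h)
  · simp
  · intro x _
    rw [add_assoc, add_self_eq_zero_of_binary, add_zero]

theorem flat_dotProduct_flat_eq_zero {U U' : Submodule (ZMod 2) V} {v : V} (hv : v ≠ 0)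
    (h : v ∈ U) (h' : v ∈ U') (x y : V) : flat U x ⬝ᵥ flat U' y = 0 :=
  sum_eq_zero_of_periodic _ v hv fun w => by rw [flat_add_of_mem h, flat_add_of_mem h']

theorem exists_mem_inf_of_finrank_lt {U U' : Submodule (ZMod 2) V}
    (h : finrank (ZMod 2) V < finrank (ZMod 2) U + finrank (ZMod 2) U') :
    ∃ v ≠ 0, v ∈ U ∧ v ∈ U' := by
  have h1 := Submodule.finrank_sup_add_finrank_inf_eq U U'
  have h2 := Submodule.finrank_le (U ⊔ U')
  have h3 : U ⊓ U' ≠ ⊥ := by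
    intro hb
    rw [hb, finrank_bot] at h1
    omega
  obtain ⟨v, hv, hv0⟩ := Submodule.exists_mem_ne_zero_of_ne_bot h3
  exact ⟨v, hv0, hv.1, hv.2⟩

/-- By dimension the directions share a nonzero vector, and translation by it pairs off the points
of the intersection. -/
theorem flat_dotProduct_flat_of_finrank_lt {U U' : Submodule (ZMod 2) V}
    (h : finrank (ZMod 2) V < finrank (ZMod 2) U + finrank (ZMod 2) U') (x y : V) :
    flat U x ⬝ᵥ flat U' y = 0 := by
  obtain ⟨v, hv, h1, h2⟩ := exists_mem_inf_of_finrank_lt h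
  exact flat_dotProduct_flat_eq_zero hv h1 h2 x y

theorem flat_dotProduct_flat_of_isCompl {U U' : Submodule (ZMod 2) V} (h : IsCompl U U')
    (x y : V) : flat U x ⬝ᵥ flat U' y = 1 := by
  have hxy : x - y ∈ U ⊔ U' := by rw [h.sup_eq_top]; trivial
  obtain ⟨u, hu, u', hu', he⟩ := Submodule.mem_sup.1 hxy
  -- Since `x - y = u + u'`, the point `x - u = y + u'` lies on both flats, and it is the only one
  -- because `U ⊓ U' = ⊥`.
  have key : ∀ w, flat U x w * flat U' y w = if w = x - u then 1 else 0 := by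
    intro w
    simp only [flat]
    by_cases hw : w = x - u
    · subst hw
      have e1 : x - u - x = -u := by abel
      have e2 : x - u - y = u' := by
        rw [sub_right_comm, ← he]; abel
      rw [e1, e2, if_pos (U.neg_mem hu), if_pos hu', if_pos rfl, one_mul]
    · rw [if_neg hw]
      by_cases h1 : w - x ∈ U
      · rw [if_neg (c := w - y ∈ U'), mul_zero]
        intro h2
        have h3 : w - x + u ∈ U ⊓ U' := by
          refine ⟨U.add_mem h1 hu, ?_⟩
          have : w - x + u = (w - y) - u' := by
            have : x = y + (u + u') := by rw [he]; abel
            rw [this]; abel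
          rw [this]
          exact U'.sub_mem h2 hu'
        rw [h.inf_eq_bot, Submodule.mem_bot] at h3
        apply hw
        rw [eq_sub_iff_add_eq, ← sub_eq_zero, ← h3]; abel
      · rw [if_neg h1, zero_mul]
  simp only [dotProduct, key, Finset.sum_ite_eq', Finset.mem_univ, if_true]

theorem hammingNorm_flat (U : Submodule (ZMod 2) V) (x : V) :
    hammingNorm (flat U x) = 2 ^ finrank (ZMod 2) U := by
  have : Fintype.card U = 2 ^ finrank (ZMod 2) U := by
    rw [Module.card_eq_pow_finrank (K := ZMod 2), ZMod.card]
  rw [← this, hammingNorm, ← Finset.card_univ]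
  refine Finset.card_bij' (fun v hv => ⟨v - x, ?_⟩) (fun u _ => u + x) ?_ ?_ ?_ ?_
  · by_contra hn
    simp [flat, hn] at hv
  · simp
  · intro u _
    simp [flat]
  · simp
  · simp

variable (V) in
/-- The functions orthogonal to all flats of dimension `j`. -/
def flatDual (j : ℕ) : Submodule (ZMod 2) (V → ZMod 2) where
  carrier := {f | ∀ U : Submodule (ZMod 2) V, finrank (ZMod 2) U = j → ∀ x, f ⬝ᵥ flat U x = 0}
  zero_mem' := fun _ _ _ => zero_dotProduct _
  add_mem' := fun hf hg U hU x => by rw [add_dotProduct, hf U hU, hg U hU, add_zero]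
  smul_mem' := fun a f hf U hU x => by rw [smul_dotProduct, hf U hU, smul_zero]

theorem flat_mem_flatDual {U : Submodule (ZMod 2) V} {j : ℕ}
    (h : finrank (ZMod 2) V < finrank (ZMod 2) U + j) (x : V) : flat U x ∈ flatDual V j :=
  fun _ hU' y => flat_dotProduct_flat_of_finrank_lt (hU' ▸ h) x y

theorem flatDual_zero : flatDual V 0 = ⊥ := by
  rw [eq_bot_iff]
  intro f hf
  rw [Submodule.mem_bot]
  funext x
  have := hf ⊥ (finrank_bot _ _) x
  simpa [dotProduct, flat, sub_eq_zero] using this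

/-- The function `f` restricted to the flat `a + T`, as a function on `T`. -/
def restrictFlat (T : Submodule (ZMod 2) V) (a : V) : (V → ZMod 2) →ₗ[ZMod 2] (T → ZMod 2) where
  toFun f t := f (a + t)
  map_add' _ _ := rfl
  map_smul' _ _ := rfl

omit [Fintype V] in
@[simp] theorem restrictFlat_apply (T : Submodule (ZMod 2) V) (a : V) (f : V → ZMod 2) (t : T) :
    restrictFlat T a f t = f (a + t) := rfl

theorem restrictFlat_mem {j : ℕ} {f : V → ZMod 2} (hf : f ∈ flatDual V j)
    (T : Submodule (ZMod 2) V) (a : V) : restrictFlat T a f ∈ flatDual T j := by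
  intro U hU x
  have := hf (U.map T.subtype) (by rw [Submodule.finrank_map_subtype_eq, hU]) (a + x)
  rw [← this]
  refine Fintype.sum_of_injective (fun t : T => a + t) ?_ _ _ ?_ ?_
  · intro s t h
    simpa using h
  · intro v hv
    have : flat (U.map T.subtype) (a + x) v = 0 := by
      rw [flat, if_neg]
      rintro ⟨u, _, hu⟩
      refine hv ⟨x + u, ?_⟩
      have : (u : V) = v - (a + x) := hu
      simp only [Submodule.coe_add, this]
      abel
    rw [this, mul_zero]
  · intro t
    have e : a + (t : V) - (a + x) = ((t - x : T) : V) := by simp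
    have h3 : ((t - x : T) : V) ∈ U.map T.subtype ↔ t - x ∈ U := by
      rw [Submodule.mem_map]
      constructor
      · rintro ⟨u, hu, he⟩
        rwa [← Subtype.ext (he : (u : V) = _)]
      · exact fun h => ⟨_, h, rfl⟩
    simp only [flat, restrictFlat_apply, e, h3]

/-- A `j`-flat of the hyperplane carrying `f` is thickened by a vector `v` transversal to it. The
resulting `(j + 1)`-flat meets the support of `f` only inside the original flat, so nothing is added
to the sum. -/
theorem restrictFlat_mem_of_support {j : ℕ} {f : V → ZMod 2} (hf : f ∈ flatDual V (j + 1))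
    (χ : Dual (ZMod 2) V) (hχ : χ ≠ 0) (a : V) (ha : ∀ x, χ x ≠ χ a → f x = 0) :
    restrictFlat (LinearMap.ker χ) a f ∈ flatDual (LinearMap.ker χ) j := by
  intro U hU x
  obtain ⟨v, hv⟩ : ∃ v, χ v ≠ 0 := by
    by_contra! h
    exact hχ (LinearMap.ext h)
  have hvU : v ∉ U.map (LinearMap.ker χ).subtype := by
    rintro ⟨u, _, rfl⟩
    exact hv u.2
  have := hf (U.map (LinearMap.ker χ).subtype ⊔ Submodule.span (ZMod 2) {v})
    (by rw [finrank_sup_span_singleton hvU, Submodule.finrank_map_subtype_eq, hU]) (a + x)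
  rw [← this]
  refine Fintype.sum_of_injective (fun t : LinearMap.ker χ => a + t) ?_ _ _ ?_ ?_
  · intro s t h
    simpa using h
  · intro w hw
    have : f w = 0 := by
      refine ha w fun h => hw ⟨⟨w - a, ?_⟩, ?_⟩
      · rw [LinearMap.mem_ker, map_sub, h, sub_self]
      · simp
    rw [this, zero_mul]
  · intro t
    have e : a + (t : V) - (a + x) = ((t - x : LinearMap.ker χ) : V) := by simp
    have h1 : ((t - x : LinearMap.ker χ) : V) - v ∉ U.map (LinearMap.ker χ).subtype := by
      rintro ⟨u, _, hu⟩
      have h2 : v = ((t - x - u : LinearMap.ker χ) : V) := by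
        have : (u : V) = ((t - x : LinearMap.ker χ) : V) - v := hu
        rw [show ((t - x - u : LinearMap.ker χ) : V) = ((t - x : LinearMap.ker χ) : V) - u from rfl,
          this]
        abel
      exact hv (by rw [h2]; exact (t - x - u).2)
    have h3 : ((t - x : LinearMap.ker χ) : V) ∈ U.map (LinearMap.ker χ).subtype ↔ t - x ∈ U := by
      rw [Submodule.mem_map]
      constructor
      · rintro ⟨u, hu, he⟩
        rwa [← Subtype.ext (he : (u : V) = _)]
      · exact fun h => ⟨_, h, rfl⟩
    simp only [flat, restrictFlat_apply, e, mem_sup_span_singleton, h1, or_false, h3]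

end Flats

/-! ### Hyperplane sections, Parseval's identity, minimum weight and minimum words -/

section Weights

open Module
open scoped Classical

variable {V : Type*} [AddCommGroup V] [Module (ZMod 2) V] [Fintype V]

noncomputable instance : Fintype (Dual (ZMod 2) V) :=
  @Fintype.ofFinite _ (DFunLike.finite _)

theorem eq_of_ne_add_one {y z : ZMod 2} (h : y ≠ z + 1) : y = z := by
  revert y z; decide

/-- The number of points in the support of `f` where the functional `χ` takes the value `z`. -/
noncomputable def sectionWeight (f : V → ZMod 2) (χ : Dual (ZMod 2) V) (z : ZMod 2) : ℕ :=
  (Finset.univ.filter fun x => f x ≠ 0 ∧ χ x = z).card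

theorem hammingNorm_restrictFlat (f : V → ZMod 2) (χ : Dual (ZMod 2) V) (a : V) :
    hammingNorm (restrictFlat (LinearMap.ker χ) a f) = sectionWeight f χ (χ a) := by
  rw [hammingNorm, sectionWeight]
  refine Finset.card_bij' (fun t _ => a + t)
    (fun x hx => ⟨x - a, by simp at hx; simp [hx.2]⟩) ?_ ?_ ?_ ?_
  · intro t ht
    have : χ (t : V) = 0 := t.2
    refine Finset.mem_filter.2 ⟨Finset.mem_univ _, (Finset.mem_filter.1 ht).2, ?_⟩
    rw [map_add, this, add_zero]
  · intro x hx
    refine Finset.mem_filter.2 ⟨Finset.mem_univ _, ?_⟩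
    rw [restrictFlat_apply, add_sub_cancel]
    exact (Finset.mem_filter.1 hx).2.1
  · simp
  · simp

theorem sectionWeight_add (f : V → ZMod 2) (χ : Dual (ZMod 2) V) :
    sectionWeight f χ 0 + sectionWeight f χ 1 = hammingNorm f := by
  rw [hammingNorm, sectionWeight, sectionWeight, ← Finset.card_union_of_disjoint]
  · congr 1
    ext x
    rcases zmod_two_cases (χ x) with h | h <;> simp [h]
  · rw [Finset.disjoint_left]
    intro x h1 h2
    simp at h1 h2
    exact zero_ne_one (h1.2.symm.trans h2.2)

theorem sectionWeight_eq_zero_iff {f : V → ZMod 2} {χ : Dual (ZMod 2) V} {z : ZMod 2} :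
    sectionWeight f χ z = 0 ↔ ∀ x, χ x = z → f x = 0 := by
  rw [sectionWeight, Finset.card_eq_zero, Finset.filter_eq_empty_iff]
  simp only [Finset.mem_univ, true_imp_iff, not_and, ne_eq]
  exact forall_congr' fun x => ⟨fun h hz => by_contra fun hf => h hf hz, fun h hf hz => hf (h hz)⟩

theorem exists_dual_eq_one {χ : Dual (ZMod 2) V} (hχ : χ ≠ 0) : ∃ v, χ v = 1 := by
  by_contra! h
  exact hχ (LinearMap.ext fun v => (zmod_two_cases (χ v)).resolve_right (h v))

theorem finrank_ker_add_one {χ : Dual (ZMod 2) V} (hχ : χ ≠ 0) :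
    finrank (ZMod 2) (LinearMap.ker χ) + 1 = finrank (ZMod 2) V :=
  Module.Dual.finrank_ker_add_one_of_ne_zero hχ

/-- The weight of `f` on the hyperplane `χ = z` is the weight of a restriction of `f`. -/
theorem sections_of_dual {f : V → ZMod 2} {χ : Dual (ZMod 2) V} (hχ : χ ≠ 0) (z : ZMod 2) :
    ∃ a, χ a = z ∧ hammingNorm (restrictFlat (LinearMap.ker χ) a f) = sectionWeight f χ z := by
  obtain ⟨v, hv⟩ := exists_dual_eq_one hχ
  rcases zmod_two_cases z with rfl | rfl
  · exact ⟨0, map_zero χ, by rw [hammingNorm_restrictFlat, map_zero]⟩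
  · exact ⟨v, hv, by rw [hammingNorm_restrictFlat, hv]⟩

theorem exists_dual_ne_zero (h : finrank (ZMod 2) V ≠ 0) : ∃ χ : Dual (ZMod 2) V, χ ≠ 0 := by
  have : 0 < finrank (ZMod 2) (Dual (ZMod 2) V) := by
    rw [Subspace.dual_finrank_eq]; omega
  have := Module.finrank_pos_iff.1 this
  exact exists_ne 0

/-- If `f` lives on a hyperplane, its restriction to it is orthogonal to smaller flats. -/
theorem exists_restrictFlat_of_sectionWeight_eq_zero {j : ℕ} {f : V → ZMod 2}
    (hf : f ∈ flatDual V (j + 1)) {χ : Dual (ZMod 2) V} (hχ : χ ≠ 0) {z : ZMod 2}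
    (hz : sectionWeight f χ z = 0) :
    ∃ a, χ a = z + 1 ∧ restrictFlat (LinearMap.ker χ) a f ∈ flatDual (LinearMap.ker χ) j ∧
      hammingNorm (restrictFlat (LinearMap.ker χ) a f) = hammingNorm f := by
  obtain ⟨a, ha, hw⟩ := sections_of_dual (f := f) hχ (z + 1)
  refine ⟨a, ha, restrictFlat_mem_of_support hf χ hχ a fun x hx => ?_, ?_⟩
  · refine sectionWeight_eq_zero_iff.1 hz x ?_
    rw [ha] at hx
    exact eq_of_ne_add_one hx
  · rw [hw, ← sectionWeight_add f χ]
    rcases zmod_two_cases z with rfl | rfl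
    · rw [hz, zero_add, zero_add]
    · rw [hz, add_zero]; rfl

/-- Cut by a hyperplane. Either `f` lives on one half, where it is even on flats of one dimension
less and the bound is unchanged, or both halves are nonzero and each contributes half of the bound.
For `j > n` the truncated exponent is 0 and the bound only says that `f` is nonzero. -/
theorem le_hammingNorm_of_mem_flatDual (n : ℕ) : ∀ (V : Type*) [AddCommGroup V]
    [Module (ZMod 2) V] [Fintype V], finrank (ZMod 2) V = n → ∀ (j : ℕ) (f : V → ZMod 2),
    f ∈ flatDual V j → f ≠ 0 → 2 ^ (n + 1 - j) ≤ hammingNorm f := by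
  induction n with
  | zero =>
    intro V _ _ _ hV j f hf hf0
    cases j with
    | zero => rw [flatDual_zero] at hf; exact absurd hf hf0
    | succ j =>
      have : 0 < hammingNorm f := hammingNorm_pos_iff.2 hf0
      rwa [show 0 + 1 - (j + 1) = 0 by omega, pow_zero]
  | succ n ih =>
    intro V _ _ _ hV j f hf hf0
    obtain ⟨χ, hχ⟩ := exists_dual_ne_zero (V := V) (by omega)
    have hk := finrank_ker_add_one hχ
    cases j with
    | zero => rw [flatDual_zero] at hf; exact absurd hf hf0
    | succ j =>
      by_cases h : ∃ z, sectionWeight f χ z = 0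
      · obtain ⟨z, hz⟩ := h
        obtain ⟨a, _, hm, hw⟩ := exists_restrictFlat_of_sectionWeight_eq_zero hf hχ hz
        have := ih _ (by omega) j _ hm (by rwa [← hammingNorm_pos_iff, hw, hammingNorm_pos_iff])
        rw [hw] at this
        rwa [show n + 1 + 1 - (j + 1) = n + 1 - j by omega]
      · push Not at h
        have key : ∀ z, 2 ^ (n + 1 - (j + 1)) ≤ sectionWeight f χ z := by
          intro z
          obtain ⟨a, _, hw⟩ := sections_of_dual (f := f) hχ z
          rw [← hw]
          refine ih _ (by omega) _ _ (restrictFlat_mem hf _ a) ?_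
          rw [← hammingNorm_ne_zero_iff, hw]
          exact h z
        rw [← sectionWeight_add f χ]
        calc 2 ^ (n + 1 + 1 - (j + 1)) ≤ 2 ^ (n + 1 - (j + 1) + 1) :=
              Nat.pow_le_pow_right (by norm_num) (by omega)
          _ ≤ _ := by rw [pow_succ, mul_two]; exact add_le_add (key 0) (key 1)

/-- The character of order two of `𝔽₂` with integer values. -/
def binarySign (z : ZMod 2) : ℤ := if z = 0 then 1 else -1

theorem binarySign_add (a b : ZMod 2) : binarySign (a + b) = binarySign a * binarySign b := by
  revert a b; decide

theorem sum_binarySign_dual (v : V) :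
    ∑ χ : Dual (ZMod 2) V, binarySign (χ v) = if v = 0 then 2 ^ finrank (ZMod 2) V else 0 := by
  split_ifs with h
  · subst h
    simp only [map_zero, binarySign, if_true, Finset.sum_const, Finset.card_univ, nsmul_eq_mul,
      mul_one]
    rw [Module.card_eq_pow_finrank (K := ZMod 2), ZMod.card, Subspace.dual_finrank_eq]
    norm_cast
  · obtain ⟨χ₀, h₀⟩ : ∃ χ₀ : Dual (ZMod 2) V, χ₀ v ≠ 0 := by
      by_contra! hcon
      exact h ((Module.forall_dual_apply_eq_zero_iff (ZMod 2) v).1 hcon)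
    have h1 : χ₀ v = 1 := (zmod_two_cases _).resolve_left h₀
    have h2 : ∑ χ : Dual (ZMod 2) V, binarySign (χ v) =
        ∑ χ : Dual (ZMod 2) V, binarySign ((χ + χ₀) v) :=
      (Equiv.sum_comp (Equiv.addRight χ₀) fun χ : Dual (ZMod 2) V => binarySign (χ v)).symm
    simp only [LinearMap.add_apply, binarySign_add, ← Finset.sum_mul, h1] at h2
    have h3 : binarySign 1 = -1 := by decide
    rw [h3] at h2
    linarith

/-- Parseval's identity: the difference of the two section weights is the Fourier coefficient at `χ`
of the indicator of the support. -/
theorem sum_sq_sectionWeight (f : V → ZMod 2) :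
    ∑ χ : Dual (ZMod 2) V, ((sectionWeight f χ 0 : ℤ) - sectionWeight f χ 1) ^ 2 =
      2 ^ finrank (ZMod 2) V * hammingNorm f := by
  have hs : ∀ χ : Dual (ZMod 2) V, (sectionWeight f χ 0 : ℤ) - sectionWeight f χ 1 =
      ∑ x with f x ≠ 0, binarySign (χ x) := by
    intro χ
    simp only [sectionWeight, Finset.card_filter, Nat.cast_sum, ← Finset.sum_sub_distrib,
      Finset.sum_filter]
    refine Finset.sum_congr rfl fun x _ => ?_
    rcases zmod_two_cases (χ x) with h | h <;> by_cases hf : f x = 0 <;> simp [h, hf, binarySign]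
  simp only [hs, sq, Finset.sum_mul_sum, ← binarySign_add, ← map_add]
  rw [Finset.sum_comm]
  have : ∀ x ∈ Finset.univ.filter (fun x => f x ≠ 0),
      ∑ χ : Dual (ZMod 2) V, ∑ y with f y ≠ 0, binarySign (χ (x + y)) =
        2 ^ finrank (ZMod 2) V := by
    intro x hx
    rw [Finset.sum_comm]
    simp only [sum_binarySign_dual]
    have h : ∀ y, x + y = 0 ↔ y = x := fun y => by
      rw [add_eq_zero_iff_neg_eq, neg_eq_self_of_binary, eq_comm]
    simp only [h, Finset.sum_ite_eq', hx, if_true]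
  rw [Finset.sum_congr rfl this, Finset.sum_const, hammingNorm, nsmul_eq_mul, mul_comm]

theorem sum_sq_sectionWeight_erase (f : V → ZMod 2) :
    ∑ χ ∈ Finset.univ.erase (0 : Dual (ZMod 2) V),
      ((sectionWeight f χ 0 : ℤ) - sectionWeight f χ 1) ^ 2 =
      2 ^ finrank (ZMod 2) V * hammingNorm f - (hammingNorm f : ℤ) ^ 2 := by
  rw [← sum_sq_sectionWeight, ← Finset.add_sum_erase _ _ (Finset.mem_univ 0)]
  have h1 : sectionWeight f 0 1 = 0 := sectionWeight_eq_zero_iff.2 fun x h => by simp at h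
  have h0 := sectionWeight_add f 0
  rw [h1, add_zero] at h0
  rw [h0, h1]
  push_cast
  ring

theorem card_erase_dual :
    ((Finset.univ.erase (0 : Dual (ZMod 2) V)).card : ℤ) = 2 ^ finrank (ZMod 2) V - 1 := by
  have : Fintype.card (Dual (ZMod 2) V) = 2 ^ finrank (ZMod 2) V := by
    rw [Module.card_eq_pow_finrank (K := ZMod 2), ZMod.card, Subspace.dual_finrank_eq]
  rw [Finset.card_erase_of_mem (Finset.mem_univ _), Finset.card_univ, this]
  rw [Nat.cast_sub Nat.one_le_two_pow]
  push_cast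
  rfl

/-- If `f` misses a half-space, induct in the other half. If not, every section has at least half of
the total weight, so every nonzero functional splits `f` evenly; Parseval's identity then makes the
weight the full `2 ^ n`, and `f` is the flat of the whole space. -/
theorem exists_flat_of_hammingNorm_eq (n : ℕ) : ∀ (V : Type*) [AddCommGroup V]
    [Module (ZMod 2) V] [Fintype V], finrank (ZMod 2) V = n → ∀ (j : ℕ), j ≤ n + 1 →
    ∀ (f : V → ZMod 2), f ∈ flatDual V j → hammingNorm f = 2 ^ (n + 1 - j) →
    ∃ (U : Submodule (ZMod 2) V) (x : V), finrank (ZMod 2) U = n + 1 - j ∧ f = flat U x := by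
  induction n with
  | zero =>
    intro V _ _ _ hV j hj f hf hw
    have hV' : Subsingleton V := Module.finrank_zero_iff.1 hV
    cases j with
    | zero =>
      rw [flatDual_zero, Submodule.mem_bot] at hf
      rw [hf, hammingNorm_zero] at hw
      simp at hw
    | succ j =>
      obtain rfl : j = 0 := by omega
      refine ⟨⊥, 0, finrank_bot _ _, ?_⟩
      funext x
      have : f ≠ 0 := by rw [← hammingNorm_pos_iff, hw]; simp
      obtain ⟨y, hy⟩ := Function.ne_iff.1 this
      rw [Subsingleton.elim y x] at hy
      rw [(zmod_two_cases (f x)).resolve_left hy, flat, if_pos]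
      rw [Subsingleton.elim (x - 0) 0]
      exact Submodule.zero_mem _
  | succ n ih =>
    intro V _ _ _ hV j hj f hf hw
    cases j with
    | zero =>
      rw [flatDual_zero, Submodule.mem_bot] at hf
      rw [hf, hammingNorm_zero] at hw
      exact absurd hw.symm (by positivity)
    | succ j =>
      rw [show n + 1 + 1 - (j + 1) = n + 1 - j by omega] at hw ⊢
      by_cases h : ∃ χ : Dual (ZMod 2) V, χ ≠ 0 ∧ ∃ z, sectionWeight f χ z = 0
      · obtain ⟨χ, hχ, z, hz⟩ := h
        have hk := finrank_ker_add_one hχ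
        obtain ⟨a, ha, hm, hw'⟩ := exists_restrictFlat_of_sectionWeight_eq_zero hf hχ hz
        obtain ⟨U, x, hU, hfx⟩ := ih (LinearMap.ker χ) (by omega) j (by omega) _ hm
          (hw'.trans hw)
        refine ⟨U.map (LinearMap.ker χ).subtype, a + x, by
          rw [Submodule.finrank_map_subtype_eq, hU], ?_⟩
        funext v
        by_cases hv : χ v = χ a
        · have hva : v - a ∈ LinearMap.ker χ := by simp [hv]
          have := congrFun hfx ⟨v - a, hva⟩
          rw [restrictFlat_apply] at this
          simp only [add_sub_cancel] at this
          rw [this]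
          have h3 : v - (a + x) ∈ U.map (LinearMap.ker χ).subtype ↔
              (⟨v - a, hva⟩ - x : LinearMap.ker χ) ∈ U := by
            rw [← sub_sub]
            rw [Submodule.mem_map]
            constructor
            · rintro ⟨u, hu, he⟩
              rwa [← Subtype.ext (he.trans rfl : (u : V) = ((⟨v - a, hva⟩ - x : LinearMap.ker χ) : V))]
            · exact fun h => ⟨_, h, rfl⟩
          simp only [flat, h3]
        · rw [flat, if_neg]
          · refine sectionWeight_eq_zero_iff.1 hz v ?_
            rw [ha] at hv
            exact eq_of_ne_add_one hv
          · rintro ⟨u, _, hu⟩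
            have hu' : (u : V) = v - (a + x) := hu
            have h1 : χ (u : V) = 0 := u.2
            have h2 : χ (x : V) = 0 := x.2
            rw [hu', map_sub, map_add, h2, add_zero, sub_eq_zero] at h1
            exact hv h1
      · push Not at h
        have key : ∀ χ : Dual (ZMod 2) V, χ ≠ 0 → sectionWeight f χ 0 = sectionWeight f χ 1 := by
          intro χ hχ
          have hk := finrank_ker_add_one hχ
          have hle : ∀ z, 2 ^ (n + 1 - (j + 1)) ≤ sectionWeight f χ z := by
            intro z
            obtain ⟨a, _, hw⟩ := sections_of_dual (f := f) hχ z
            rw [← hw]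
            refine le_hammingNorm_of_mem_flatDual n _ (by omega) _ _ (restrictFlat_mem hf _ a) ?_
            rw [← hammingNorm_ne_zero_iff, hw]
            exact h χ hχ z
          have hs := sectionWeight_add f χ
          rw [hw] at hs
          have h0 := hle 0
          have h1 := hle 1
          -- When `j = n + 1` the total weight is 1 and the exponents no longer drop by one; a
          -- single point cannot have two nonempty sections.
          rcases Nat.lt_or_ge j (n + 1) with hj' | hj'
          · rw [show n + 1 - j = n + 1 - (j + 1) + 1 by omega, pow_succ] at hs
            omega
          · rw [show n + 1 - j = 0 by omega] at hs
            rw [show n + 1 - (j + 1) = 0 by omega] at h0 h1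
            omega
        have hp := sum_sq_sectionWeight_erase f
        rw [Finset.sum_eq_zero] at hp
        · have hpos : (hammingNorm f : ℤ) ≠ 0 := by rw [hw]; positivity
          have h2 : (hammingNorm f : ℤ) = 2 ^ finrank (ZMod 2) V := by
            have : (hammingNorm f : ℤ) * (hammingNorm f) =
              (hammingNorm f : ℤ) * 2 ^ finrank (ZMod 2) V := by linarith
            exact mul_left_cancel₀ hpos this
          have h3 : hammingNorm f = Fintype.card V := by
            rw [Module.card_eq_pow_finrank (K := ZMod 2), ZMod.card]
            exact_mod_cast h2
          refine ⟨⊤, 0, ?_, ?_⟩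
          · rw [finrank_top]
            refine Nat.pow_right_injective le_rfl ?_
            show 2 ^ _ = 2 ^ _
            rw [← hw]
            exact_mod_cast h2.symm
          · funext x
            have : x ∈ Finset.univ.filter (fun x => f x ≠ 0) := by
              rw [Finset.eq_univ_of_card _ h3]
              exact Finset.mem_univ x
            simp only [Finset.mem_filter, Finset.mem_univ, true_and] at this
            rw [(zmod_two_cases (f x)).resolve_left this, flat, if_pos Submodule.mem_top]
        · intro χ hχ
          rw [key χ (Finset.ne_of_mem_erase hχ), sub_self]
          rfl

end Weights

/-! ### Gaps just above the minimum weight, and a dimension bound -/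

section ExcludedWeights

open Module
open scoped Classical

variable {V : Type*} [AddCommGroup V] [Module (ZMod 2) V] [Fintype V]

/-- A flat of dimension `j + 1` is the disjoint union of two parallel flats of dimension `j`. -/
theorem flatDual_le_succ (j : ℕ) : flatDual V j ≤ flatDual V (j + 1) := by
  intro f hf U' hU' x
  obtain ⟨U, hU, hUj⟩ := exists_le_finrank (U := U') (k := j) (by omega)
  obtain ⟨v, hv, hvU, hd⟩ := exists_of_finrank_succ hU (by omega)
  rw [flat_split hU hv hvU hd, dotProduct_add, hf U hUj, hf U hUj, add_zero]

theorem flatDual_mono {i j : ℕ} (h : i ≤ j) : flatDual V i ≤ flatDual V j :=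
  monotone_nat_of_le_succ flatDual_le_succ h

theorem cast_hammingNorm {ι : Type*} [Fintype ι] (f : ι → ZMod 2) :
    (hammingNorm f : ZMod 2) = ∑ x, f x := by
  rw [hammingNorm, Finset.card_filter, Nat.cast_sum]
  refine Finset.sum_congr rfl fun x _ => ?_
  rcases zmod_two_cases (f x) with h | h <;> simp [h]

omit [Fintype V] in
theorem flat_top (x : V) : flat ⊤ x = 1 := by
  funext v
  simp [flat]

theorem even_hammingNorm_of_mem_flatDual {j : ℕ} (hj : j ≤ finrank (ZMod 2) V) {f : V → ZMod 2}
    (hf : f ∈ flatDual V j) : Even (hammingNorm f) := by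
  have := flatDual_mono hj hf ⊤ (finrank_top _ _) 0
  rw [flat_top, dotProduct_one, ← cast_hammingNorm] at this
  exact (ZMod.natCast_eq_zero_iff_even).1 this

theorem hammingNorm_add_one_add {ι : Type*} [Fintype ι] (f : ι → ZMod 2) :
    hammingNorm (f + 1) + hammingNorm f = Fintype.card ι := by
  have : hammingNorm (f + 1) = (Finset.univ.filter fun x => ¬ f x ≠ 0).card := by
    rw [hammingNorm]
    congr 1
    refine Finset.filter_congr fun x _ => ?_
    rcases zmod_two_cases (f x) with h | h <;> simp [h]
    rfl
  rw [this, hammingNorm, add_comm]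
  exact Finset.card_filter_add_card_filter_not (s := Finset.univ) (fun x => f x ≠ 0)

theorem one_mem_flatDual (j : ℕ) : (1 : V → ZMod 2) ∈ flatDual V (j + 1) := by
  rw [← flat_top 0]
  exact flat_mem_flatDual (by rw [finrank_top]; omega) 0

theorem card_eq_two_pow : Fintype.card V = 2 ^ finrank (ZMod 2) V := by
  rw [Module.card_eq_pow_finrank (K := ZMod 2), ZMod.card]

theorem le_sectionWeight {n j : ℕ} (hn : finrank (ZMod 2) V = n + 1) {f : V → ZMod 2}
    (hf : f ∈ flatDual V j) {χ : Dual (ZMod 2) V} (hχ : χ ≠ 0) {z : ZMod 2}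
    (hz : sectionWeight f χ z ≠ 0) : 2 ^ (n + 1 - j) ≤ sectionWeight f χ z := by
  have hk := finrank_ker_add_one hχ
  obtain ⟨a, _, hw⟩ := sections_of_dual (f := f) hχ z
  rw [← hw]
  refine le_hammingNorm_of_mem_flatDual n _ (by omega) _ _ (restrictFlat_mem hf _ a) ?_
  rwa [← hammingNorm_ne_zero_iff, hw]

theorem sum_sq_sectionWeight_le {f : V → ZMod 2} {B : ℤ}
    (h : ∀ χ : Dual (ZMod 2) V, χ ≠ 0 →
      ((sectionWeight f χ 0 : ℤ) - sectionWeight f χ 1) ^ 2 ≤ B) :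
    (2 ^ finrank (ZMod 2) V * hammingNorm f - (hammingNorm f : ℤ) ^ 2 : ℤ) ≤
      (2 ^ finrank (ZMod 2) V - 1) * B := by
  rw [← sum_sq_sectionWeight_erase, ← card_erase_dual, ← nsmul_eq_mul]
  exact Finset.sum_le_card_nsmul _ _ _ fun χ hχ => h χ (Finset.ne_of_mem_erase hχ)

/-- Here the minimum weight is 8 and nonzero sections have weight at least 4. If no half-space is
missed, sections split 10 with difference at most 2, and Parseval's identity bounds the dimension of
`V` by 4; there the complement would have weight 6, below the minimum. -/
theorem hammingNorm_ne_ten (n : ℕ) : ∀ (V : Type*) [AddCommGroup V]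
    [Module (ZMod 2) V] [Fintype V], finrank (ZMod 2) V = n → ∀ (j : ℕ), n + 1 = j + 3 →
    ∀ (f : V → ZMod 2), f ∈ flatDual V j → hammingNorm f ≠ 10 := by
  induction n with
  | zero => intro V _ _ _ _ j hj; omega
  | succ n ih =>
    intro V _ _ _ hV j hj f hf hw
    cases j with
    | zero =>
      rw [flatDual_zero, Submodule.mem_bot] at hf
      rw [hf, hammingNorm_zero] at hw
      omega
    | succ j =>
      by_cases h : ∃ χ : Dual (ZMod 2) V, χ ≠ 0 ∧ ∃ z, sectionWeight f χ z = 0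
      · obtain ⟨χ, hχ, z, hz⟩ := h
        have hk := finrank_ker_add_one hχ
        obtain ⟨a, ha, hm, hw'⟩ := exists_restrictFlat_of_sectionWeight_eq_zero hf hχ hz
        exact ih (LinearMap.ker χ) (by omega) j (by omega) _ hm (hw'.trans hw)
      · push Not at h
        have hb := sum_sq_sectionWeight_le (f := f) (B := 4) (by
          intro χ hχ
          have h0 := le_sectionWeight hV hf hχ (h χ hχ 0)
          have h1 := le_sectionWeight hV hf hχ (h χ hχ 1)
          rw [show n + 1 - (j + 1) = 2 by omega] at h0 h1
          have hs := sectionWeight_add f χ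
          rw [← sq_abs]
          have : |((sectionWeight f χ 0 : ℤ) - sectionWeight f χ 1)| ≤ 2 := by
            rw [abs_le]; omega
          nlinarith [abs_nonneg ((sectionWeight f χ 0 : ℤ) - sectionWeight f χ 1)])
        rw [hV, hw] at hb
        have hc := hammingNorm_add_one_add f
        rw [hw, card_eq_two_pow, hV] at hc
        have hn3 : 3 ≤ n := by
          by_contra hlt
          have : 2 ^ (n + 1) ≤ 2 ^ 3 := Nat.pow_le_pow_right (by norm_num) (by omega)
          omega
        -- Parseval reads `10·2^(n+1) - 100 ≤ 4·(2^(n+1) - 1)`, that is `2^(n+1) ≤ 16`.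
        have hn4 : n < 4 := by
          by_contra hlt
          have : (2 : ℤ) ^ 5 ≤ 2 ^ (n + 1) := pow_le_pow_right₀ (by norm_num) (by omega)
          norm_num at hb this
          linarith
        obtain rfl : n = 3 := by omega
        have := le_hammingNorm_of_mem_flatDual 4 V hV (j + 1) (f + 1)
          ((flatDual V (j + 1)).add_mem hf (one_mem_flatDual j))
          (by rw [← hammingNorm_pos_iff]; omega)
        rw [show 4 + 1 - (j + 1) = 3 by omega] at this
        omega

/-- The same method with minimum weight 16 and sections at least 8 leaves dimensions 5 and 6. In
dimension 5 the complement has weight 12. In dimension 6 weight 10 is excluded for the sections, so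
every splitting is 8 + 12 and Parseval becomes an exact, false equation. -/
theorem hammingNorm_ne_twenty (n : ℕ) : ∀ (V : Type*) [AddCommGroup V]
    [Module (ZMod 2) V] [Fintype V], finrank (ZMod 2) V = n → ∀ (j : ℕ), n + 1 = j + 4 →
    ∀ (f : V → ZMod 2), f ∈ flatDual V j → hammingNorm f ≠ 20 := by
  induction n with
  | zero => intro V _ _ _ _ j hj; omega
  | succ n ih =>
    intro V _ _ _ hV j hj f hf hw
    cases j with
    | zero =>
      rw [flatDual_zero, Submodule.mem_bot] at hf
      rw [hf, hammingNorm_zero] at hw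
      omega
    | succ j =>
      by_cases h : ∃ χ : Dual (ZMod 2) V, χ ≠ 0 ∧ ∃ z, sectionWeight f χ z = 0
      · obtain ⟨χ, hχ, z, hz⟩ := h
        have hk := finrank_ker_add_one hχ
        obtain ⟨a, ha, hm, hw'⟩ := exists_restrictFlat_of_sectionWeight_eq_zero hf hχ hz
        exact ih (LinearMap.ker χ) (by omega) j (by omega) _ hm (hw'.trans hw)
      · push Not at h
        have hsec : ∀ χ : Dual (ZMod 2) V, χ ≠ 0 →
            8 ≤ sectionWeight f χ 0 ∧ 8 ≤ sectionWeight f χ 1 ∧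
            sectionWeight f χ 0 + sectionWeight f χ 1 = 20 := by
          intro χ hχ
          have h0 := le_sectionWeight hV hf hχ (h χ hχ 0)
          have h1 := le_sectionWeight hV hf hχ (h χ hχ 1)
          rw [show n + 1 - (j + 1) = 3 by omega] at h0 h1
          exact ⟨h0, h1, (sectionWeight_add f χ).trans hw⟩
        have hb := sum_sq_sectionWeight_le (f := f) (B := 16) (by
          intro χ hχ
          have hs := hsec χ hχ
          rw [← sq_abs]
          have : |((sectionWeight f χ 0 : ℤ) - sectionWeight f χ 1)| ≤ 4 := by
            rw [abs_le]; omega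
          nlinarith [abs_nonneg ((sectionWeight f χ 0 : ℤ) - sectionWeight f χ 1)])
        rw [hV, hw] at hb
        have hc := hammingNorm_add_one_add f
        rw [hw, card_eq_two_pow, hV] at hc
        have hn3 : 4 ≤ n := by
          by_contra hlt
          have : 2 ^ (n + 1) ≤ 2 ^ 4 := Nat.pow_le_pow_right (by norm_num) (by omega)
          omega
        -- Parseval reads `20·2^(n+1) - 400 ≤ 16·(2^(n+1) - 1)`, that is `2^(n+1) ≤ 96`.
        have hn4 : n < 6 := by
          by_contra hlt
          have : (2 : ℤ) ^ 7 ≤ 2 ^ (n + 1) := pow_le_pow_right₀ (by norm_num) (by omega)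
          norm_num at hb this
          linarith
        rcases (by omega : n = 4 ∨ n = 5) with rfl | rfl
        · have := le_hammingNorm_of_mem_flatDual 5 V hV (j + 1) (f + 1)
            ((flatDual V (j + 1)).add_mem hf (one_mem_flatDual j))
            (by rw [← hammingNorm_pos_iff]; omega)
          rw [show 5 + 1 - (j + 1) = 4 by omega] at this
          omega
        · obtain rfl : j = 2 := by omega
          have heq := sum_sq_sectionWeight_erase f
          have : ∀ χ ∈ Finset.univ.erase (0 : Dual (ZMod 2) V),
              ((sectionWeight f χ 0 : ℤ) - sectionWeight f χ 1) ^ 2 = 16 := by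
            intro χ hχ
            replace hχ := Finset.ne_of_mem_erase hχ
            have hs := hsec χ hχ
            have hk := finrank_ker_add_one hχ
            obtain ⟨a, _, ha⟩ := sections_of_dual (f := f) hχ 0
            have hm := restrictFlat_mem hf (LinearMap.ker χ) a
            have h10 := hammingNorm_ne_ten 5 _ (by omega) 3 (by omega) _ hm
            have hev := even_hammingNorm_of_mem_flatDual (by omega) hm
            rw [ha] at h10 hev
            have : sectionWeight f χ 0 = 8 ∨ sectionWeight f χ 0 = 12 := by
              obtain ⟨c, hc⟩ := hev
              omega
            rcases this with h8 | h12
            · rw [h8, show sectionWeight f χ 1 = 12 by omega]; norm_num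
            · rw [h12, show sectionWeight f χ 1 = 8 by omega]; norm_num
          -- The two sides are 63·16 = 1008 and 64·20 - 400 = 880.
          rw [Finset.sum_congr rfl this, Finset.sum_const, nsmul_eq_mul, card_erase_dual, hV,
            hw] at heq
          norm_num at heq

/-- Pascal's rule: restrict to a hyperplane. A function in the kernel lives on the other half, where
it is even on flats of one dimension less. -/
theorem finrank_flatDual_le (n : ℕ) : ∀ (V : Type*) [AddCommGroup V]
    [Module (ZMod 2) V] [Fintype V], finrank (ZMod 2) V = n → ∀ (j : ℕ),
    finrank (ZMod 2) (flatDual V j) ≤ ∑ i ∈ Finset.range j, n.choose i := by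
  induction n with
  | zero =>
    intro V _ _ _ hV j
    cases j with
    | zero => rw [flatDual_zero, finrank_bot]; exact Nat.zero_le _
    | succ j =>
      refine (Submodule.finrank_le _).trans ?_
      rw [Module.finrank_fintype_fun_eq_card, card_eq_two_pow, hV, Finset.sum_range_succ']
      simp
  | succ n ih =>
    intro V _ _ _ hV j
    cases j with
    | zero => rw [flatDual_zero, finrank_bot]; exact Nat.zero_le _
    | succ j =>
      obtain ⟨χ, hχ⟩ := exists_dual_ne_zero (V := V) (by omega)
      obtain ⟨v, hv⟩ := exists_dual_eq_one hχ
      have hk := finrank_ker_add_one hχ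
      have hT : finrank (ZMod 2) (LinearMap.ker χ) = n := by omega
      let R : flatDual V (j + 1) →ₗ[ZMod 2] flatDual (LinearMap.ker χ) (j + 1) :=
        (restrictFlat (LinearMap.ker χ) 0).restrict fun f hf => restrictFlat_mem hf _ 0
      have h0 : ∀ f ∈ LinearMap.ker R, ∀ x, χ x = 0 → (f : V → ZMod 2) x = 0 := by
        intro f hf x hx
        have := congrFun (congrArg Subtype.val (LinearMap.mem_ker.1 hf)) ⟨x, hx⟩
        simpa [R, LinearMap.restrict_apply] using this
      let S : LinearMap.ker R →ₗ[ZMod 2] flatDual (LinearMap.ker χ) j :=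
        LinearMap.codRestrict _ ((restrictFlat (LinearMap.ker χ) v) ∘ₗ
          (flatDual V (j + 1)).subtype ∘ₗ (LinearMap.ker R).subtype) (by
            intro f
            refine restrictFlat_mem_of_support f.1.2 χ hχ v fun x hx => h0 _ f.2 x ?_
            exact (zmod_two_cases _).resolve_right (hv ▸ hx))
      have hS : Function.Injective S := by
        rw [← LinearMap.ker_eq_bot, LinearMap.ker_eq_bot']
        intro f hf
        refine Subtype.ext (Subtype.ext (funext fun x => ?_))
        rcases zmod_two_cases (χ x) with h | h
        · exact h0 _ f.2 x h
        · have : f.1.1 (v + (x - v)) = 0 :=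
            congrFun (congrArg Subtype.val hf) ⟨x - v, by simp [h, hv]⟩
          rwa [add_sub_cancel] at this
      have h1 := LinearMap.finrank_range_add_finrank_ker R
      have h2 := LinearMap.finrank_le_finrank_of_injective hS
      have h3 := Submodule.finrank_le (LinearMap.range R)
      have h4 := ih _ hT (j + 1)
      have h5 := ih _ hT j
      have h6 : ∑ i ∈ Finset.range (j + 1), (n + 1).choose i =
          ∑ i ∈ Finset.range (j + 1), n.choose i + ∑ i ∈ Finset.range j, n.choose i := by
        rw [Finset.sum_range_succ', Finset.sum_range_succ' (fun i => n.choose i)]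
        simp only [Nat.choose_succ_succ, Finset.sum_add_distrib, Nat.choose_zero_right]
        ring
      omega

end ExcludedWeights

/-! ### Duality of binary codes and the MacWilliams identity -/

section MacWilliams

open scoped Classical

variable {ι : Type*} [Fintype ι]

theorem finrank_add_finrank_dualCode (C : Submodule (ZMod 2) (ι → ZMod 2)) :
    Module.finrank (ZMod 2) C + Module.finrank (ZMod 2) (dualCode C) = Fintype.card ι := by
  have h : (dualCode C).map (dotProductEquiv (ZMod 2) ι).toLinearMap = C.dualAnnihilator := by
    ext φ
    rw [Submodule.mem_map, Submodule.mem_dualAnnihilator]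
    constructor
    · rintro ⟨u, hu, rfl⟩ c hc
      exact hu c hc
    · intro hφ
      obtain ⟨u, rfl⟩ := (dotProductEquiv (ZMod 2) ι).surjective φ
      exact ⟨u, fun c hc => hφ c hc, rfl⟩
  have h1 := Subspace.finrank_add_finrank_dualAnnihilator_eq C
  rw [← h, LinearEquiv.finrank_map_eq] at h1
  rw [h1, Module.finrank_fintype_fun_eq_card]

theorem sum_binarySign_dotProduct (C : Submodule (ZMod 2) (ι → ZMod 2)) (u : ι → ZMod 2) :
    ∑ c : C, binarySign (u ⬝ᵥ (c : ι → ZMod 2)) =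
      if u ∈ dualCode C then (Fintype.card C : ℤ) else 0 := by
  split_ifs with h
  · have : ∀ c : C, binarySign (u ⬝ᵥ (c : ι → ZMod 2)) = 1 := fun c => by
      rw [h c c.2]; rfl
    simp [this]
  · obtain ⟨c₀, hc₀, h₀⟩ : ∃ c₀ ∈ C, u ⬝ᵥ c₀ ≠ 0 := by
      by_contra! hcon
      exact h hcon
    have h1 : u ⬝ᵥ c₀ = 1 := (zmod_two_cases _).resolve_left h₀
    have h2 := (Equiv.sum_comp (Equiv.addRight (⟨c₀, hc₀⟩ : C))
      fun c : C => binarySign (u ⬝ᵥ (c : ι → ZMod 2))).symm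
    simp only [Equiv.coe_addRight, Submodule.coe_add, dotProduct_add, binarySign_add,
      ← Finset.sum_mul, h1] at h2
    have h3 : binarySign 1 = -1 := by decide
    rw [h3] at h2
    linarith

variable {R : Type*} [CommRing R]

/-- Sign and weight are both multiplicative over coordinates, so the sum is a product of two-term
sums: `1 - t` where `c` is nonzero, `1 + t` elsewhere. -/
theorem sum_binarySign_mul_pow (c : ι → ZMod 2) (t : R) :
    ∑ u : ι → ZMod 2, (binarySign (u ⬝ᵥ c) : R) * t ^ hammingNorm u =
      (1 - t) ^ hammingNorm c * (1 + t) ^ (Fintype.card ι - hammingNorm c) := by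
  have hs : ∀ (s : Finset ι) (g : ι → ZMod 2),
      binarySign (∑ i ∈ s, g i) = ∏ i ∈ s, binarySign (g i) := by
    intro s g
    induction s using Finset.induction_on with
    | empty => rfl
    | insert i s hi ih => rw [Finset.sum_insert hi, Finset.prod_insert hi, binarySign_add, ih]
  have h1 : ∀ u : ι → ZMod 2, (binarySign (u ⬝ᵥ c) : R) * t ^ hammingNorm u =
      ∏ i, (binarySign (u i * c i) : R) * (if u i ≠ 0 then t else 1) := by
    intro u
    rw [Finset.prod_mul_distrib, ← Int.cast_prod, ← hs, Finset.prod_ite, Finset.prod_const,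
      Finset.prod_const_one, mul_one]
    rfl
  have h2 : ∀ i, ∑ z : ZMod 2, (binarySign (z * c i) : R) * (if z ≠ 0 then t else 1) =
      if c i ≠ 0 then 1 - t else 1 + t := by
    intro i
    have : (Finset.univ : Finset (ZMod 2)) = {0, 1} := by decide
    rw [this, Finset.sum_pair zero_ne_one]
    rcases zmod_two_cases (c i) with h | h
    · simp [h, binarySign]
    · simp [h, binarySign]; ring
  have h3 := Finset.prod_univ_sum (fun _ : ι => (Finset.univ : Finset (ZMod 2)))
    (fun i z => (binarySign (z * c i) : R) * (if z ≠ 0 then t else 1))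
  rw [Fintype.piFinset_univ] at h3
  simp only [h1]
  rw [← h3]
  simp only [h2]
  rw [Finset.prod_ite, Finset.prod_const, Finset.prod_const]
  congr 2
  have := Finset.card_filter_add_card_filter_not (s := Finset.univ) (fun x => c x ≠ 0)
  rw [← Finset.card_univ, hammingNorm, ← this]
  simp

/-- The MacWilliams identity. -/
theorem macWilliams (C : Submodule (ZMod 2) (ι → ZMod 2)) (t : R) :
    (Fintype.card C : R) * ∑ u : dualCode C, t ^ hammingNorm (u : ι → ZMod 2) =
      ∑ c : C, (1 - t) ^ hammingNorm (c : ι → ZMod 2) *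
        (1 + t) ^ (Fintype.card ι - hammingNorm (c : ι → ZMod 2)) := by
  simp only [← sum_binarySign_mul_pow]
  rw [Finset.sum_comm]
  simp only [← Finset.sum_mul, ← Int.cast_sum, sum_binarySign_dotProduct]
  have : ∀ u : ι → ZMod 2, (((if u ∈ dualCode C then (Fintype.card C : ℤ) else 0 : ℤ) : R) *
      t ^ hammingNorm u) = if u ∈ dualCode C then (Fintype.card C : R) * t ^ hammingNorm u
      else 0 := by
    intro u
    split_ifs <;> simp
  simp only [this]
  rw [← Finset.sum_filter, Finset.mul_sum]
  exact (Finset.sum_subtype (Finset.univ.filter fun u => u ∈ dualCode C) (fun u => by simp)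
    fun u => (Fintype.card C : R) * t ^ hammingNorm u).symm

theorem weightDistribution_eq_card (C : Submodule (ZMod 2) (ι → ZMod 2)) (i : ℕ) :
    weightDistribution C i =
      (Finset.univ.filter fun c : C => hammingNorm (c : ι → ZMod 2) = i).card := by
  rw [weightDistribution, ← Set.ncard_coe_finset]
  refine (Set.ncard_congr (fun (c : C) _ => (c : ι → ZMod 2)) ?_ ?_ ?_).symm
  · intro c hc
    exact ⟨c.2, by simpa using hc⟩
  · intro c d _ _ h
    exact Subtype.ext h
  · intro c hc
    exact ⟨⟨c, hc.1⟩, by simpa using hc.2, rfl⟩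

theorem sum_hammingNorm (C : Submodule (ZMod 2) (ι → ZMod 2)) (g : ℕ → R) :
    ∑ c : C, g (hammingNorm (c : ι → ZMod 2)) =
      ∑ i ∈ Finset.range (Fintype.card ι + 1), (weightDistribution C i : R) * g i := by
  rw [← Finset.sum_fiberwise_of_maps_to (s := Finset.univ)
    (t := Finset.range (Fintype.card ι + 1)) (g := fun c : C => hammingNorm (c : ι → ZMod 2))]
  · refine Finset.sum_congr rfl fun i _ => ?_
    rw [weightDistribution_eq_card, ← nsmul_eq_mul]
    refine Finset.sum_eq_card_nsmul fun c hc => ?_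
    rw [(Finset.mem_filter.1 hc).2]
  · intro c _
    exact Finset.mem_range.2 (Nat.lt_succ_of_le hammingNorm_le_card_fintype)

theorem card_mul_sum_weightDistribution {C : Submodule (ZMod 2) (ι → ZMod 2)}
    (hC : IsSelfDual C) (t : R) :
    (Fintype.card C : R) *
        ∑ i ∈ Finset.range (Fintype.card ι + 1), (weightDistribution C i : R) * t ^ i =
      ∑ i ∈ Finset.range (Fintype.card ι + 1), (weightDistribution C i : R) *
        ((1 - t) ^ i * (1 + t) ^ (Fintype.card ι - i)) := by
  have := macWilliams C t
  have hC' : dualCode C = C := hC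
  rwa [hC', sum_hammingNorm C (fun i => t ^ i),
    sum_hammingNorm C (fun i => (1 - t) ^ i * (1 + t) ^ (Fintype.card ι - i))] at this

theorem finrank_of_isSelfDual {C : Submodule (ZMod 2) (ι → ZMod 2)} (hC : IsSelfDual C) :
    2 * Module.finrank (ZMod 2) C = Fintype.card ι := by
  have := finrank_add_finrank_dualCode C
  have hC' : dualCode C = C := hC
  rw [hC'] at this
  omega

/-- All weights are even, so the all-one word is orthogonal to the code. This yields the symmetry of
the weight distribution. -/
theorem one_mem_of_isSelfDual {C : Submodule (ZMod 2) (ι → ZMod 2)} (hC : IsSelfDual C)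
    (hd : IsDoublyEven C) : (1 : ι → ZMod 2) ∈ C := by
  have hC' : dualCode C = C := hC
  rw [← hC']
  intro c hc
  rw [one_dotProduct, ← cast_hammingNorm]
  obtain ⟨k, hk⟩ := hd c hc
  rw [hk]
  push_cast
  rw [show (4 : ZMod 2) = 0 from rfl, zero_mul]

theorem weightDistribution_symm {C : Submodule (ZMod 2) (ι → ZMod 2)} (h1 : (1 : ι → ZMod 2) ∈ C)
    {i : ℕ} (hi : i ≤ Fintype.card ι) :
    weightDistribution C (Fintype.card ι - i) = weightDistribution C i := by
  refine Set.ncard_congr (fun c _ => c + 1) ?_ ?_ ?_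
  · rintro c ⟨hc, hw⟩
    refine ⟨C.add_mem hc h1, ?_⟩
    have := hammingNorm_add_one_add c
    omega
  · intro c d _ _ h
    exact add_right_cancel h
  · rintro c ⟨hc, hw⟩
    refine ⟨c + 1, ⟨C.add_mem hc h1, ?_⟩, ?_⟩
    · have := hammingNorm_add_one_add c
      omega
    · rw [add_assoc, add_self_eq_zero_of_binary, add_zero]

theorem weightDistribution_eq_zero_of_not_dvd {C : Submodule (ZMod 2) (ι → ZMod 2)}
    (hd : IsDoublyEven C) {i : ℕ} (hi : ¬ 4 ∣ i) : weightDistribution C i = 0 := by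
  rw [weightDistribution, Set.ncard_eq_zero]
  refine Set.eq_empty_of_forall_notMem ?_
  rintro c ⟨hc, rfl⟩
  exact hi (hd c hc)

theorem weightDistribution_eq_zero_of_card_lt {C : Submodule (ZMod 2) (ι → ZMod 2)} {i : ℕ}
    (hi : Fintype.card ι < i) : weightDistribution C i = 0 := by
  rw [weightDistribution, Set.ncard_eq_zero]
  refine Set.eq_empty_of_forall_notMem ?_
  rintro c ⟨_, rfl⟩
  exact absurd hammingNorm_le_card_fintype (not_le.2 hi)

end MacWilliams

/-! ### A self-dual doubly-even code of length 128 is determined by its weights below 24 -/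

section Gleason

open PowerSeries

/-- If `z - 1` has order one, a polynomial in `z` of degree less than `k` divisible by `X ^ k`
is zero. -/
theorem eq_zero_of_X_pow_dvd_aeval {p : Polynomial ℚ} {k : ℕ} (hp : p.natDegree < k)
    {z e : ℚ⟦X⟧} (hz : z - 1 = X * e) (he : constantCoeff e ≠ 0)
    (h : (X : ℚ⟦X⟧) ^ k ∣ Polynomial.aeval z p) : p = 0 := by
  by_contra hp0
  -- With `r` the multiplicity of the root 1 of `p`, substituting `z` gives `X ^ r` times a series
  -- with nonzero constant term, and `r ≤ natDegree p < k`.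
  obtain ⟨q, hq, hnd⟩ := Polynomial.exists_eq_pow_rootMultiplicity_mul_and_not_dvd p hp0 1
  set r := p.rootMultiplicity 1 with hr
  have hrk : r < k := by
    refine lt_of_le_of_lt ?_ hp
    have := Polynomial.natDegree_le_of_dvd (p.pow_rootMultiplicity_dvd 1) hp0
    rwa [Polynomial.natDegree_pow, Polynomial.natDegree_X_sub_C, mul_one] at this
  have hz1 : constantCoeff z = 1 := by
    have : z = 1 + X * e := by rw [← hz]; ring
    rw [this]
    simp
  have hq0 : constantCoeff (Polynomial.aeval z q) ≠ 0 := by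
    have : constantCoeff (Polynomial.aeval z q) = q.eval 1 := by
      rw [← hz1, Polynomial.aeval_def, Polynomial.hom_eval₂, ← Polynomial.eval₂_id]
      congr 1
    rw [this]
    intro h0
    exact hnd (Polynomial.dvd_iff_isRoot.2 h0)
  rw [hq] at h
  simp only [map_mul, map_pow, map_sub, Polynomial.aeval_X, map_one, hz] at h
  rw [mul_pow, mul_assoc, show k = r + (k - r) by omega, pow_add] at h
  have h2 := (mul_dvd_mul_iff_left (pow_ne_zero r (X_ne_zero (R := ℚ)))).1 h
  have h3 : (X : ℚ⟦X⟧) ∣ e ^ r * Polynomial.aeval z q :=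
    (dvd_pow_self _ (by omega)).trans h2
  rw [X_dvd_iff, map_mul, map_pow] at h3
  exact mul_ne_zero (pow_ne_zero _ he) hq0 h3

variable {ι ι' : Type*} [Fintype ι] [Fintype ι']

/-- The difference `d` of the two weight distributions satisfies the self-dual MacWilliams identity
and lives on the multiples of 4 from 24 to 104. One side is divisible by `X ^ 24`; the other is a
unit times a polynomial of degree at most 20 in `((1 - X) / (1 + X)) ^ 4`, a series which is 1 plus
a term of order one. Too many zeros force the polynomial to vanish. -/
theorem weightDistribution_eq_of_lt {C : Submodule (ZMod 2) (ι → ZMod 2)}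
    {C' : Submodule (ZMod 2) (ι' → ZMod 2)} (hι : Fintype.card ι = 128)
    (hι' : Fintype.card ι' = 128) (hC : IsSelfDual C) (hC' : IsSelfDual C')
    (hd : IsDoublyEven C) (hd' : IsDoublyEven C')
    (h : ∀ i < 24, weightDistribution C i = weightDistribution C' i) (i : ℕ) :
    weightDistribution C i = weightDistribution C' i := by
  classical
  set d : ℕ → ℚ := fun i => (weightDistribution C i : ℚ) - weightDistribution C' i with hdef
  have hcard : Fintype.card C' = Fintype.card C := by
    rw [card_eq_two_pow, card_eq_two_pow]
    congr 1
    have := finrank_of_isSelfDual hC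
    have := finrank_of_isSelfDual hC'
    omega
  have hlt : ∀ i < 24, d i = 0 := fun i hi => by simp only [hdef, h i hi, sub_self]
  -- Weights above 104 are complements of weights below 24.
  have hzero : ∀ i ≤ 128, i ∉ (Finset.range 21).image (fun k => 24 + 4 * k) → d i = 0 := by
    intro i hi hk
    by_cases h4 : 4 ∣ i
    · rcases lt_or_ge i 24 with h1 | h1
      · exact hlt i h1
      · rcases lt_or_ge 104 i with h2 | h2
        · have e := weightDistribution_symm (one_mem_of_isSelfDual hC hd)
            (i := 128 - i) (by omega)
          have e' := weightDistribution_symm (one_mem_of_isSelfDual hC' hd')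
            (i := 128 - i) (by omega)
          rw [hι, show 128 - (128 - i) = i by omega] at e
          rw [hι', show 128 - (128 - i) = i by omega] at e'
          simp only [hdef, e, e', h (128 - i) (by omega), sub_self]
        · obtain ⟨c, rfl⟩ := h4
          exact absurd (Finset.mem_image.2 ⟨c - 6, Finset.mem_range.2 (by omega), by omega⟩) hk
    · simp only [hdef, weightDistribution_eq_zero_of_not_dvd hd h4,
        weightDistribution_eq_zero_of_not_dvd hd' h4, sub_self]
  have hM : (Fintype.card C : ℚ⟦X⟧) * ∑ i ∈ Finset.range 129, PowerSeries.C (d i) * X ^ i =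
      ∑ i ∈ Finset.range 129, PowerSeries.C (d i) * ((1 - X) ^ i * (1 + X) ^ (128 - i)) := by
    have e := card_mul_sum_weightDistribution hC (X : ℚ⟦X⟧)
    have e' := card_mul_sum_weightDistribution hC' (X : ℚ⟦X⟧)
    rw [hι] at e
    rw [hι', hcard] at e'
    simp only [hdef, map_sub, map_natCast, sub_mul, Finset.sum_sub_distrib, mul_sub]
    rw [← e, ← e']
  set w : ℚ⟦X⟧ := (1 + X)⁻¹ with hw
  have hw1 : (1 + X) * w = 1 := PowerSeries.mul_inv_cancel _ (by simp)
  set p : Polynomial ℚ :=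
    ∑ k ∈ Finset.range 21, Polynomial.C (d (24 + 4 * k)) * Polynomial.X ^ k with hp
  have hR : ∑ i ∈ Finset.range 129, PowerSeries.C (d i) * ((1 - X) ^ i * (1 + X) ^ (128 - i)) =
      ((1 - X) ^ 24 * (1 + X) ^ 104) * Polynomial.aeval (((1 - X) * w) ^ 4) p := by
    rw [← Finset.sum_subset (s₁ := (Finset.range 21).image (fun k => 24 + 4 * k))]
    · rw [Finset.sum_image (by intro a _ b _ hab; simpa using hab), hp, map_sum, Finset.mul_sum]
      refine Finset.sum_congr rfl fun k hk => ?_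
      have hk' := Finset.mem_range.1 hk
      rw [map_mul, map_pow, Polynomial.aeval_X, Polynomial.aeval_C]
      have : (1 + X : ℚ⟦X⟧) ^ 104 * w ^ (4 * k) = (1 + X) ^ (128 - (24 + 4 * k)) := by
        rw [show 104 = (128 - (24 + 4 * k)) + 4 * k by omega, pow_add, mul_assoc, ← mul_pow, hw1,
          one_pow, mul_one]
      rw [← this, ← pow_mul, mul_pow, pow_add]
      simp only [PowerSeries.algebraMap_apply, Algebra.algebraMap_self, RingHom.id_apply]
      ring
    · intro i hi
      obtain ⟨k, hk, rfl⟩ := Finset.mem_image.1 hi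
      have := Finset.mem_range.1 hk
      exact Finset.mem_range.2 (by omega)
    · intro i hi hi'
      rw [hzero i (by have := Finset.mem_range.1 hi; omega) hi', map_zero, zero_mul]
  have hunit : IsUnit ((1 - X : ℚ⟦X⟧) ^ 24 * (1 + X) ^ 104) := by
    rw [PowerSeries.isUnit_iff_constantCoeff]
    simp
  have hdvd : (X : ℚ⟦X⟧) ^ 24 ∣ Polynomial.aeval (((1 - X) * w) ^ 4) p := by
    rw [← hunit.dvd_mul_left, ← hR, ← hM]
    refine Dvd.dvd.mul_left (Finset.dvd_sum fun i _ => ?_) _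
    rcases lt_or_ge i 24 with h1 | h1
    · rw [hlt i h1, map_zero, zero_mul]
      exact dvd_zero _
    · exact (pow_dvd_pow X h1).mul_left _
  have hdeg : p.natDegree < 24 := by
    refine lt_of_le_of_lt (Polynomial.natDegree_sum_le_of_forall_le (n := 20) _ _ ?_) (by norm_num)
    intro k hk
    have := Finset.mem_range.1 hk
    exact (Polynomial.natDegree_C_mul_X_pow_le _ _).trans (by omega)
  have hp0 : p = 0 := by
    -- The witness comes from `(1 - X) ^ 4 - (1 + X) ^ 4 = -8 X (1 + X ^ 2)`.
    refine eq_zero_of_X_pow_dvd_aeval hdeg (e := PowerSeries.C (-8) * (1 + X ^ 2) * w ^ 4) ?_ ?_ hdvd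
    · have : (1 + X) ^ 4 * w ^ 4 = 1 := by rw [← mul_pow, hw1, one_pow]
      rw [mul_pow, map_neg, map_ofNat]
      linear_combination this
    · simp [hw]
  have hd0 : ∀ k < 21, d (24 + 4 * k) = 0 := by
    intro k hk
    have : p.coeff k = d (24 + 4 * k) := by
      simp [hp, Polynomial.finsetSum_coeff, Polynomial.coeff_C_mul, Polynomial.coeff_X_pow, hk]
    rw [← this, hp0, Polynomial.coeff_zero]
  have hfin : d i = 0 := by
    rcases lt_or_ge 128 i with h1 | h1
    · simp only [hdef, weightDistribution_eq_zero_of_card_lt (hι ▸ h1),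
        weightDistribution_eq_zero_of_card_lt (hι' ▸ h1), sub_self]
    · by_cases hi : i ∈ (Finset.range 21).image (fun k => 24 + 4 * k)
      · obtain ⟨k, hk, rfl⟩ := Finset.mem_image.1 hi
        exact hd0 k (Finset.mem_range.1 hk)
      · exact hzero i h1 hi
  have := sub_eq_zero.1 hfin
  exact_mod_cast this

end Gleason

/-! ### Counting subspaces and flats -/

section Counting

open Module

variable {V : Type*} [AddCommGroup V] [Module (ZMod 2) V] [Finite V]

/-- Linearly independent `k`-families correspond to `k`-dimensional subspaces with a basis. -/
noncomputable def linearIndependentFiberEquiv (k : ℕ)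
    (W : {W : Submodule (ZMod 2) V // finrank (ZMod 2) W = k}) :
    {s : {s : Fin k → V // LinearIndependent (ZMod 2) s} //
      Submodule.span (ZMod 2) (Set.range s.1) = W.1} ≃
    {t : Fin k → W.1 // LinearIndependent (ZMod 2) t} where
  toFun s := ⟨fun i => ⟨s.1.1 i, s.2.le (Submodule.subset_span ⟨i, rfl⟩)⟩,
    LinearIndependent.of_comp W.1.subtype s.1.2⟩
  invFun t := ⟨⟨fun i => t.1 i, t.2.map' W.1.subtype (Submodule.ker_subtype _)⟩, by
    refine Submodule.eq_of_le_of_finrank_eq ?_ ?_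
    · rw [Submodule.span_le]
      rintro _ ⟨i, rfl⟩
      exact (t.1 i).2
    · have h : LinearIndependent (ZMod 2) fun i => (t.1 i : V) :=
        t.2.map' W.1.subtype (Submodule.ker_subtype _)
      rw [finrank_span_eq_card h, W.2, Fintype.card_fin]⟩
  left_inv _ := rfl
  right_inv _ := rfl

/-- Linearly independent `k`-tuples are sorted by their span; keeping the Gaussian binomial in
product form avoids division. -/
theorem card_subspaces_mul {k : ℕ} (hk : k ≤ finrank (ZMod 2) V) :
    Nat.card {W : Submodule (ZMod 2) V // finrank (ZMod 2) W = k} *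
      ∏ i : Fin k, (2 ^ k - 2 ^ i.val) = ∏ i : Fin k, (2 ^ finrank (ZMod 2) V - 2 ^ i.val) := by
  let F : {s : Fin k → V // LinearIndependent (ZMod 2) s} →
      {W : Submodule (ZMod 2) V // finrank (ZMod 2) W = k} :=
    fun s => ⟨Submodule.span (ZMod 2) (Set.range s.1), by
      rw [finrank_span_eq_card s.2, Fintype.card_fin]⟩
  have h1 := card_linearIndependent (K := ZMod 2) hk
  rw [ZMod.card] at h1
  rw [← h1, ← Nat.card_congr (Equiv.sigmaFiberEquiv F)]
  have := Fintype.ofFinite {W : Submodule (ZMod 2) V // finrank (ZMod 2) W = k}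
  rw [Nat.card_sigma]
  have h2 : ∀ W : {W : Submodule (ZMod 2) V // finrank (ZMod 2) W = k},
      Nat.card {s // F s = W} = ∏ i : Fin k, (2 ^ k - 2 ^ i.val) := by
    intro W
    have h3 := card_linearIndependent (K := ZMod 2) (V := W.1) W.2.ge
    rw [ZMod.card, W.2] at h3
    rw [← h3, ← Nat.card_congr (linearIndependentFiberEquiv k W)]
    refine Nat.card_congr (Equiv.subtypeEquivRight fun s => ?_)
    exact Subtype.ext_iff
  simp only [h2, Finset.sum_const, Finset.card_univ, smul_eq_mul, Nat.card_eq_fintype_card]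

theorem finrank_map_mkQ_add {L W : Submodule (ZMod 2) V} (h : L ≤ W) :
    finrank (ZMod 2) (W.map L.mkQ) + finrank (ZMod 2) L = finrank (ZMod 2) W := by
  have h1 := LinearMap.finrank_range_add_finrank_ker (L.mkQ.domRestrict W)
  have h2 : LinearMap.range (L.mkQ.domRestrict W) = W.map L.mkQ :=
    LinearMap.range_domRestrict _ _
  have h3 : LinearMap.ker (L.mkQ.domRestrict W) = L.submoduleOf W := by
    rw [LinearMap.ker_domRestrict, Submodule.ker_mkQ]
    rfl
  rw [h2, h3, (Submodule.submoduleOfEquivOfLe h).finrank_eq] at h1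
  exact h1

theorem card_subspaces_ge (L : Submodule (ZMod 2) V) (k : ℕ) :
    Nat.card {W : Submodule (ZMod 2) V // L ≤ W ∧ finrank (ZMod 2) W = k + finrank (ZMod 2) L} =
      Nat.card {W : Submodule (ZMod 2) (V ⧸ L) // finrank (ZMod 2) W = k} := by
  refine Nat.card_congr
    { toFun := fun W => ⟨W.1.map L.mkQ, ?_⟩
      invFun := fun W => ⟨W.1.comap L.mkQ, Submodule.le_comap_mkQ _ _, ?_⟩
      left_inv := fun W => ?_
      right_inv := fun W => ?_ }
  · have := finrank_map_mkQ_add W.2.1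
    have := W.2.2
    omega
  · have := finrank_map_mkQ_add (Submodule.le_comap_mkQ L W.1)
    rw [Submodule.map_comap_eq_of_surjective L.mkQ_surjective, W.2] at this
    omega
  · refine Subtype.ext ?_
    show (W.1.map L.mkQ).comap L.mkQ = W.1
    rw [Submodule.comap_map_mkQ, sup_eq_right]
    exact W.2.1
  · exact Subtype.ext (Submodule.map_comap_eq_of_surjective L.mkQ_surjective _)

theorem card_subspaces_six_three (h : finrank (ZMod 2) V = 6) :
    Nat.card {W : Submodule (ZMod 2) V // finrank (ZMod 2) W = 3} = 1395 := by
  have := card_subspaces_mul (V := V) (k := 3) (by omega)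
  rw [h] at this
  simp only [Fin.prod_univ_succ, Fin.prod_univ_zero] at this
  norm_num at this
  omega

theorem card_subspaces_six_four (h : finrank (ZMod 2) V = 6) :
    Nat.card {W : Submodule (ZMod 2) V // finrank (ZMod 2) W = 4} = 651 := by
  have := card_subspaces_mul (V := V) (k := 4) (by omega)
  rw [h] at this
  simp only [Fin.prod_univ_succ, Fin.prod_univ_zero] at this
  norm_num at this
  omega

theorem card_subspaces_seven_four (h : finrank (ZMod 2) V = 7) :
    Nat.card {W : Submodule (ZMod 2) V // finrank (ZMod 2) W = 4} = 11811 := by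
  have := card_subspaces_mul (V := V) (k := 4) (by omega)
  rw [h] at this
  simp only [Fin.prod_univ_succ, Fin.prod_univ_zero] at this
  norm_num at this
  omega

theorem card_subspaces_four_two (h : finrank (ZMod 2) V = 4) :
    Nat.card {W : Submodule (ZMod 2) V // finrank (ZMod 2) W = 2} = 35 := by
  have := card_subspaces_mul (V := V) (k := 2) (by omega)
  rw [h] at this
  simp only [Fin.prod_univ_succ, Fin.prod_univ_zero] at this
  norm_num at this
  omega

theorem card_subspaces_four_one (h : finrank (ZMod 2) V = 4) :
    Nat.card {W : Submodule (ZMod 2) V // finrank (ZMod 2) W = 1} = 15 := by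
  have := card_subspaces_mul (V := V) (k := 1) (by omega)
  rw [h] at this
  simpa using this

theorem card_subspaces_five_two (h : finrank (ZMod 2) V = 5) :
    Nat.card {W : Submodule (ZMod 2) V // finrank (ZMod 2) W = 2} = 155 := by
  have := card_subspaces_mul (V := V) (k := 2) (by omega)
  rw [h] at this
  simp only [Fin.prod_univ_succ, Fin.prod_univ_zero] at this
  norm_num at this
  omega

theorem card_quotient (U : Submodule (ZMod 2) V) :
    Nat.card (V ⧸ U) = 2 ^ (finrank (ZMod 2) V - finrank (ZMod 2) U) := by
  rw [Module.natCard_eq_pow_finrank (K := ZMod 2), Nat.card_zmod]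
  congr 1
  have := Submodule.finrank_quotient_add_finrank U
  omega

/-- The flat with direction `U` given by an element of the quotient by `U`. -/
noncomputable def flatOfQuotient (U : Submodule (ZMod 2) V) (q : V ⧸ U) : V → ZMod 2 :=
  flat U (Function.surjInv U.mkQ_surjective q)

omit [Finite V] in
theorem flatOfQuotient_mk (U : Submodule (ZMod 2) V) (x : V) :
    flatOfQuotient U (U.mkQ x) = flat U x := by
  rw [flatOfQuotient, flat_eq_iff, ← Submodule.Quotient.mk_eq_zero, Submodule.Quotient.mk_sub,
    ← Submodule.mkQ_apply, ← Submodule.mkQ_apply, Function.surjInv_eq U.mkQ_surjective, sub_self]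

omit [Finite V] in
theorem flatOfQuotient_injective (U : Submodule (ZMod 2) V) :
    Function.Injective (flatOfQuotient U) := by
  intro q q' h
  obtain ⟨x, rfl⟩ := U.mkQ_surjective q
  obtain ⟨y, rfl⟩ := U.mkQ_surjective q'
  rw [flatOfQuotient_mk, flatOfQuotient_mk, flat_eq_iff] at h
  exact ((Submodule.Quotient.eq U).2 h).symm

/-- A flat determines its direction, and the flats with direction `U` correspond to the elements of
`V ⧸ U`. -/
theorem ncard_flats (k : ℕ) :
    {f : V → ZMod 2 | ∃ (U : Submodule (ZMod 2) V) (x : V),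
      finrank (ZMod 2) U = k ∧ f = flat U x}.ncard =
    Nat.card {W : Submodule (ZMod 2) V // finrank (ZMod 2) W = k} *
      2 ^ (finrank (ZMod 2) V - k) := by
  let F : (Σ U : {W : Submodule (ZMod 2) V // finrank (ZMod 2) W = k}, V ⧸ U.1) → V → ZMod 2 :=
    fun p => flatOfQuotient p.1.1 p.2
  have hF : Function.Injective F := by
    rintro ⟨⟨U, hU⟩, q⟩ ⟨⟨U', hU'⟩, q'⟩ h
    obtain rfl : U = U' := flat_inj h
    obtain rfl : q = q' := flatOfQuotient_injective U h
    rfl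
  have hr : {f : V → ZMod 2 | ∃ (U : Submodule (ZMod 2) V) (x : V),
      finrank (ZMod 2) U = k ∧ f = flat U x} = Set.range F := by
    ext f
    constructor
    · rintro ⟨U, x, hU, rfl⟩
      exact ⟨⟨⟨U, hU⟩, U.mkQ x⟩, flatOfQuotient_mk U x⟩
    · rintro ⟨⟨⟨U, hU⟩, q⟩, rfl⟩
      exact ⟨U, _, hU, rfl⟩
  have := Fintype.ofFinite {W : Submodule (ZMod 2) V // finrank (ZMod 2) W = k}
  have := fun U : {W : Submodule (ZMod 2) V // finrank (ZMod 2) W = k} =>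
    Finite.of_surjective _ U.1.mkQ_surjective
  rw [hr, ← Nat.card_coe_set_eq, Nat.card_range_of_injective hF, Nat.card_sigma]
  have h2 : ∀ U : {W : Submodule (ZMod 2) V // finrank (ZMod 2) W = k},
      Nat.card (V ⧸ U.1) = 2 ^ (finrank (ZMod 2) V - k) := fun U => by rw [card_quotient, U.2]
  simp only [h2, Finset.sum_const, Finset.card_univ, smul_eq_mul, Nat.card_eq_fintype_card]

end Counting

/-! ### Dimensions under a polarity -/

section PolarityDimension

open Module

variable {V : Type*} [AddCommGroup V] [Module (ZMod 2) V] [Finite V]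
  {π : Submodule (ZMod 2) V → Submodule (ZMod 2) V}

omit [Finite V] in
theorem IsPolarity.lt_of_lt (hπ : IsPolarity π) {U U' : Submodule (ZMod 2) V} (h : U < U') :
    π U' < π U :=
  lt_of_le_of_ne (hπ.1 h.le) fun he => h.ne (hπ.2.injective he).symm

/-- Only strict antitonicity is needed: descending from `U` to zero one dimension at a time bounds
`π U` from above, ascending from `U` to the whole space bounds it from below. -/
theorem IsPolarity.finrank_add (hπ : IsPolarity π) (U : Submodule (ZMod 2) V) :
    finrank (ZMod 2) (π U) + finrank (ZMod 2) U = finrank (ZMod 2) V := by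
  apply le_antisymm
  · have : ∀ (k : ℕ) (U : Submodule (ZMod 2) V), finrank (ZMod 2) U = k →
        finrank (ZMod 2) (π U) + k ≤ finrank (ZMod 2) V := by
      intro k
      induction k with
      | zero => exact fun U _ => Submodule.finrank_le _
      | succ k ih =>
        intro U hU
        obtain ⟨U', hU', hk⟩ := exists_le_finrank (U := U) (k := k) (by omega)
        have hlt : U' < U := lt_of_le_of_ne hU' (by rintro rfl; omega)
        have h1 := Submodule.finrank_lt_finrank_of_lt (hπ.lt_of_lt hlt)
        have h2 := ih U' hk
        omega
    exact this _ U rfl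
  · have : ∀ (k : ℕ) (U : Submodule (ZMod 2) V), finrank (ZMod 2) U + k = finrank (ZMod 2) V →
        k ≤ finrank (ZMod 2) (π U) := by
      intro k
      induction k with
      | zero => exact fun U _ => Nat.zero_le _
      | succ k ih =>
        intro U hU
        obtain ⟨v, hv⟩ := exists_notMem_of_finrank_lt (U := U) (by omega)
        have hf := finrank_sup_span_singleton hv
        have hlt : U < U ⊔ Submodule.span (ZMod 2) {v} :=
          lt_of_le_of_ne le_sup_left (by intro h; rw [← h] at hf; omega)
        have h1 := Submodule.finrank_lt_finrank_of_lt (hπ.lt_of_lt hlt)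
        have h2 := ih (U ⊔ Submodule.span (ZMod 2) {v}) (by omega)
        omega
    have h1 := Submodule.finrank_le U
    have := this (finrank (ZMod 2) V - finrank (ZMod 2) U) U (by omega)
    omega

omit [Finite V] in
theorem IsPolarity.le_iff (hπ : IsPolarity π) {U U' : Submodule (ZMod 2) V} :
    U ≤ π U' ↔ U' ≤ π U := by
  constructor <;> intro h <;> simpa only [hπ.2 _] using hπ.1 h

omit [Finite V] in
theorem IsPolarity.inf_eq (hπ : IsPolarity π) (U U' : Submodule (ZMod 2) V) :
    π U ⊓ π U' = π (U ⊔ U') := by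
  apply le_antisymm
  · rw [hπ.le_iff]
    exact sup_le (hπ.le_iff.1 inf_le_left) (hπ.le_iff.1 inf_le_right)
  · exact le_inf (hπ.1 le_sup_left) (hπ.1 le_sup_right)

/-- A polarity preserves the dimension of the meet of two subspaces of half the dimension. -/
theorem IsPolarity.finrank_inf (hπ : IsPolarity π) {U U' : Submodule (ZMod 2) V}
    (h : finrank (ZMod 2) U + finrank (ZMod 2) U' = finrank (ZMod 2) V) :
    finrank (ZMod 2) ↥(π U ⊓ π U') = finrank (ZMod 2) ↥(U ⊓ U') := by
  have h1 := hπ.finrank_add (U ⊔ U')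
  have h2 := Submodule.finrank_sup_add_finrank_inf_eq U U'
  rw [hπ.inf_eq]
  omega

end PolarityDimension

/-! ### Self-orthogonality and double evenness from generators -/

section SelfOrthogonal

open scoped Classical

variable {ι : Type*} [Fintype ι]

theorem hammingNorm_add_add (x y : ι → ZMod 2) :
    hammingNorm (x + y) + 2 * (Finset.univ.filter fun i => x i * y i ≠ 0).card =
      hammingNorm x + hammingNorm y := by
  simp only [hammingNorm, Finset.card_filter, Finset.mul_sum, ← Finset.sum_add_distrib]
  refine Finset.sum_congr rfl fun i _ => ?_
  rw [Pi.add_apply]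
  rcases zmod_two_cases (x i) with h | h <;> rcases zmod_two_cases (y i) with h' | h' <;>
    simp [h, h', show (1 : ZMod 2) + 1 = 0 from rfl]

theorem selfOrthogonal_span {G : Set (ι → ZMod 2)} (hG : ∀ x ∈ G, ∀ y ∈ G, x ⬝ᵥ y = 0) :
    Submodule.span (ZMod 2) G ≤ dualCode (Submodule.span (ZMod 2) G) := by
  intro x hx y hy
  induction hy using Submodule.span_induction with
  | mem y hy =>
    induction hx using Submodule.span_induction with
    | mem x hx => exact hG x hx y hy
    | zero => exact zero_dotProduct y
    | add a b _ _ ha hb => rw [add_dotProduct, ha, hb, add_zero]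
    | smul r a _ ha => rw [smul_dotProduct, ha, smul_zero]
  | zero => exact dotProduct_zero x
  | add a b _ _ ha hb => rw [dotProduct_add, ha, hb, add_zero]
  | smul r a _ ha => rw [dotProduct_smul, ha, smul_zero]

/-- Orthogonal words overlap in an even number of places, and the weight of a sum drops by twice the
overlap. -/
theorem isDoublyEven_span {G : Set (ι → ZMod 2)} (hG : ∀ x ∈ G, ∀ y ∈ G, x ⬝ᵥ y = 0)
    (hw : ∀ x ∈ G, 4 ∣ hammingNorm x) : IsDoublyEven (Submodule.span (ZMod 2) G) := by
  intro x hx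
  have hso := selfOrthogonal_span hG
  induction hx using Submodule.span_induction with
  | mem x hx => exact hw x hx
  | zero => rw [hammingNorm_zero]; exact dvd_zero 4
  | add a b ha hb iha ihb =>
    have h0 : a ⬝ᵥ b = 0 := hso ha b hb
    have h1 := hammingNorm_add_add a b
    have h2 : Even (Finset.univ.filter fun i => a i * b i ≠ 0).card := by
      have := cast_hammingNorm (fun i => a i * b i)
      rw [show ∑ i, a i * b i = 0 from h0] at this
      exact ZMod.natCast_eq_zero_iff_even.1 this
    obtain ⟨c, hc⟩ := h2
    omega
  | smul r a ha iha =>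
    rcases zmod_two_cases r with rfl | rfl
    · rw [zero_smul, hammingNorm_zero]; exact dvd_zero 4
    · rwa [one_smul]

theorem isSelfDual_of_le {C : Submodule (ZMod 2) (ι → ZMod 2)} (h : C ≤ dualCode C)
    (hd : 2 * Module.finrank (ZMod 2) (dualCode C) ≤ Fintype.card ι) : IsSelfDual C := by
  have := finrank_add_finrank_dualCode C
  exact (Submodule.eq_of_le_of_finrank_le h (by omega)).symm

theorem hasParameters_of_hammingNorm {C : Submodule (ZMod 2) (ι → ZMod 2)} {n k d : ℕ}
    (hn : Fintype.card ι = n) (hk : Module.finrank (ZMod 2) C = k)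
    (hd : ∀ c ∈ C, c ≠ 0 → d ≤ hammingNorm c) (hex : ∃ c ∈ C, c ≠ 0 ∧ hammingNorm c = d) :
    HasParameters C n k d := by
  have hdist : ∀ x y : ι → ZMod 2, hammingDist x y = hammingNorm (x - y) := fun x y => by
    rw [hammingDist_comm, hammingDist_eq_hammingNorm, neg_add_eq_sub]
  refine ⟨hn, hk, ?_, ?_⟩
  · obtain ⟨c, hc, hc0, hcd⟩ := hex
    exact ⟨c, hc, 0, C.zero_mem, hc0, by rw [hammingDist_zero_right, hcd]⟩
  · rintro r ⟨x, hx, y, hy, hxy, rfl⟩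
    rw [hdist]
    exact hd _ (C.sub_mem hx hy) (sub_ne_zero.2 hxy)

end SelfOrthogonal

/-! ### Words on a disjoint union of two coordinate sets -/

section SumElim

theorem dotProduct_sumElim_zero {α β : Type*} [Fintype α] [Fintype β]
    (c : α ⊕ β → ZMod 2) (a : α → ZMod 2) :
    c ⬝ᵥ Sum.elim a 0 = (c ∘ Sum.inl) ⬝ᵥ a := by
  rw [← Sum.elim_comp_inl_inr c, sumElim_dotProduct_sumElim, dotProduct_zero, add_zero]
  rfl

theorem dotProduct_sumElim {α β : Type*} [Fintype α] [Fintype β]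
    (c : α ⊕ β → ZMod 2) (a : α → ZMod 2) (b : β → ZMod 2) :
    c ⬝ᵥ Sum.elim a b = (c ∘ Sum.inl) ⬝ᵥ a + (c ∘ Sum.inr) ⬝ᵥ b := by
  rw [← Sum.elim_comp_inl_inr c, sumElim_dotProduct_sumElim]
  rfl

theorem hammingNorm_sumElim {α β : Type*} [Fintype α] [Fintype β] (a : α → ZMod 2)
    (b : β → ZMod 2) : hammingNorm (Sum.elim a b) = hammingNorm a + hammingNorm b := by
  simp only [hammingNorm, Finset.card_filter, Fintype.sum_sum_type, Sum.elim_inl, Sum.elim_inr]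
  rfl

theorem hammingNorm_eq_add {α β : Type*} [Fintype α] [Fintype β] (c : α ⊕ β → ZMod 2) :
    hammingNorm c = hammingNorm (c ∘ Sum.inl) + hammingNorm (c ∘ Sum.inr) := by
  conv_lhs => rw [← Sum.elim_comp_inl_inr c]
  exact hammingNorm_sumElim _ _

end SumElim

/-! ### The polarity code on two copies of the hyperplane is self-dual -/

section PolarityCode

open Module
open scoped Classical

variable {K : Type*} [AddCommGroup K] [Module (ZMod 2) K] [Fintype K]
  {π : Submodule (ZMod 2) K → Submodule (ZMod 2) K}

/-- The generators of the polarity code: on a pair of copies of `K` (the hyperplane and its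
complement), the four-dimensional subspaces of the first copy, and for each three-dimensional
subspace `U` the pairs consisting of `π U` and a translate of `U`. -/
def polarityGenerators (π : Submodule (ZMod 2) K → Submodule (ZMod 2) K) :
    Set (K ⊕ K → ZMod 2) :=
  {c | ∃ W : Submodule (ZMod 2) K, finrank (ZMod 2) W = 4 ∧ c = Sum.elim (flat W 0) 0} ∪
  {c | ∃ (U : Submodule (ZMod 2) K) (x : K), finrank (ZMod 2) U = 3 ∧
    c = Sum.elim (flat (π U) 0) (flat U x)}

/-- The code spanned by the extended blocks of the polarity design. -/
def polarityCode (π : Submodule (ZMod 2) K → Submodule (ZMod 2) K) :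
    Submodule (ZMod 2) (K ⊕ K → ZMod 2) :=
  Submodule.span (ZMod 2) (polarityGenerators π)

theorem IsPolarity.finrank_eq_three (hπ : IsPolarity π) (hK : finrank (ZMod 2) K = 6)
    {U : Submodule (ZMod 2) K} (hU : finrank (ZMod 2) U = 3) : finrank (ZMod 2) (π U) = 3 := by
  have := hπ.finrank_add U
  omega

theorem isCompl_of_inf_eq_bot {U U' : Submodule (ZMod 2) K}
    (h : finrank (ZMod 2) K ≤ finrank (ZMod 2) U + finrank (ZMod 2) U')
    (hd : finrank (ZMod 2) ↥(U ⊓ U') = 0) : IsCompl U U' := by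
  have h1 := Submodule.finrank_sup_add_finrank_inf_eq U U'
  refine ⟨disjoint_iff.2 (Submodule.finrank_eq_zero.1 hd), codisjoint_iff.2 ?_⟩
  exact Submodule.eq_top_of_finrank_eq (le_antisymm (Submodule.finrank_le _) (by omega))

/-- For complementary dimensions the product depends only on the directions: 1 if they meet
trivially, 0 otherwise. The polarity preserves the dimension of the meet. Hence both halves of two
generators built on 3-spaces contribute the same amount. -/
theorem IsPolarity.flat_dotProduct_flat (hπ : IsPolarity π) {U U' : Submodule (ZMod 2) K}
    (h : finrank (ZMod 2) U + finrank (ZMod 2) U' = finrank (ZMod 2) K) (x y x' y' : K) :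
    flat (π U) x ⬝ᵥ flat (π U') y = flat U x' ⬝ᵥ flat U' y' := by
  have hi := hπ.finrank_inf h
  have h1 := hπ.finrank_add U
  have h2 := hπ.finrank_add U'
  by_cases h0 : finrank (ZMod 2) ↥(U ⊓ U') = 0
  · rw [flat_dotProduct_flat_of_isCompl (isCompl_of_inf_eq_bot (by omega) h0),
      flat_dotProduct_flat_of_isCompl (isCompl_of_inf_eq_bot (by omega) (hi.trans h0))]
  · have key : ∀ A B : Submodule (ZMod 2) K, finrank (ZMod 2) ↥(A ⊓ B) ≠ 0 → ∀ x y : K,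
        flat A x ⬝ᵥ flat B y = 0 := by
      intro A B hAB x y
      obtain ⟨v, hv, hv0⟩ := Submodule.exists_mem_ne_zero_of_ne_bot
        (fun hb => hAB (by rw [hb, finrank_bot]) : A ⊓ B ≠ ⊥)
      exact flat_dotProduct_flat_eq_zero hv0 hv.1 hv.2 x y
    rw [key _ _ h0, key _ _ (hi ▸ h0)]

theorem polarityGenerators_orthogonal (hπ : IsPolarity π) (hK : finrank (ZMod 2) K = 6) :
    ∀ c ∈ polarityGenerators π, ∀ d ∈ polarityGenerators π, c ⬝ᵥ d = 0 := by
  rintro c (⟨W, hW, rfl⟩ | ⟨U, x, hU, rfl⟩) d (⟨W', hW', rfl⟩ | ⟨U', x', hU', rfl⟩) <;>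
    rw [sumElim_dotProduct_sumElim]
  · rw [flat_dotProduct_flat_of_finrank_lt (by omega), zero_dotProduct, add_zero]
  · have := hπ.finrank_eq_three hK hU'
    rw [flat_dotProduct_flat_of_finrank_lt (by omega), zero_dotProduct, add_zero]
  · have := hπ.finrank_eq_three hK hU
    rw [flat_dotProduct_flat_of_finrank_lt (by omega), dotProduct_zero, add_zero]
  · rw [hπ.flat_dotProduct_flat (by omega) 0 0 x x']
    exact add_self_eq_zero_of_binary _

theorem polarityCode_isDoublyEven (hπ : IsPolarity π) (hK : finrank (ZMod 2) K = 6) :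
    IsDoublyEven (polarityCode π) := by
  refine isDoublyEven_span (polarityGenerators_orthogonal hπ hK) ?_
  rintro c (⟨W, hW, rfl⟩ | ⟨U, x, hU, rfl⟩)
  · rw [hammingNorm_sumElim, hammingNorm_flat, hW, hammingNorm_zero]; norm_num
  · rw [hammingNorm_sumElim, hammingNorm_flat, hammingNorm_flat, hU, hπ.finrank_eq_three hK hU]
    norm_num

/-- A function with even sums on all `(k + 1)`-dimensional linear subspaces containing a
`k`-dimensional linear subspace has the same sums on all of its translates. -/
theorem dotProduct_flat_translate {f : K → ZMod 2} {k : ℕ}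
    (hf : ∀ W : Submodule (ZMod 2) K, finrank (ZMod 2) W = k + 1 → f ⬝ᵥ flat W 0 = 0)
    {Z : Submodule (ZMod 2) K} (hZ : finrank (ZMod 2) Z = k) (x : K) :
    f ⬝ᵥ flat Z x = f ⬝ᵥ flat Z 0 := by
  by_cases hx : x ∈ Z
  · rw [flat_eq_iff.2 (show x - 0 ∈ Z by simpa using hx)]
  · have h1 := hf _ ((finrank_sup_span_singleton hx).trans (by rw [hZ]))
    rw [flat_split le_sup_left (Submodule.mem_sup_right (Submodule.mem_span_singleton_self x)) hx
      (fun w hw => mem_sup_span_singleton.1 hw), zero_add, dotProduct_add] at h1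
    rw [← add_self_eq_zero_of_binary (f ⬝ᵥ flat Z 0)] at h1
    exact add_left_cancel h1

/-- The first kind of generators gives only linear subspaces. A translate of `W` splits into two
translates of a `k`-dimensional `Z`, and all translates of `Z` carry the same sum. -/
theorem mem_flatDual_of_linear {f : K → ZMod 2} {k : ℕ}
    (hf : ∀ W : Submodule (ZMod 2) K, finrank (ZMod 2) W = k + 1 → f ⬝ᵥ flat W 0 = 0) :
    f ∈ flatDual K (k + 1) := by
  intro W hW x
  obtain ⟨Z, hZ, hZk⟩ := exists_le_finrank (U := W) (k := k) (by omega)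
  obtain ⟨v, hv, hvU, hd⟩ := exists_of_finrank_succ hZ (by omega)
  rw [flat_split hZ hv hvU hd, dotProduct_add, dotProduct_flat_translate hf hZk,
    dotProduct_flat_translate hf hZk (x + v)]
  exact add_self_eq_zero_of_binary _

theorem left_mem_flatDual_four {c : K ⊕ K → ZMod 2} (hc : c ∈ dualCode (polarityCode π)) :
    c ∘ Sum.inl ∈ flatDual K 4 := by
  refine mem_flatDual_of_linear fun W hW => ?_
  rw [← dotProduct_sumElim_zero]
  exact hc _ (Submodule.subset_span (Or.inl ⟨W, hW, rfl⟩))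

theorem dotProduct_generator {c : K ⊕ K → ZMod 2} (hc : c ∈ dualCode (polarityCode π))
    {U : Submodule (ZMod 2) K} (hU : finrank (ZMod 2) U = 3) (x : K) :
    (c ∘ Sum.inl) ⬝ᵥ flat (π U) 0 + (c ∘ Sum.inr) ⬝ᵥ flat U x = 0 := by
  rw [← dotProduct_sumElim]
  exact hc _ (Submodule.subset_span (Or.inr ⟨U, x, hU, rfl⟩))

theorem right_mem_flatDual_three {c : K ⊕ K → ZMod 2} (hc : c ∈ dualCode (polarityCode π))
    (h0 : c ∘ Sum.inl = 0) : c ∘ Sum.inr ∈ flatDual K 3 := by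
  intro U hU x
  have := dotProduct_generator hc hU x
  rwa [h0, zero_dotProduct, zero_add] at this

theorem left_mem_flatDual_three (hπ : IsPolarity π) (hK : finrank (ZMod 2) K = 6)
    {c : K ⊕ K → ZMod 2} (hc : c ∈ dualCode (polarityCode π)) (h0 : c ∘ Sum.inr = 0) :
    c ∘ Sum.inl ∈ flatDual K 3 := by
  refine mem_flatDual_of_linear fun U hU => ?_
  -- Using the generator built on `π U` makes its left half `π (π U) = U`.
  have := dotProduct_generator hc (hπ.finrank_eq_three hK hU) 0
  rwa [h0, zero_dotProduct, add_zero, hπ.2] at this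

/-- Two generators with the same `U` have the same left half, so the sums over parallel translates
of `U` agree on the right; a 4-flat is a union of two such translates. -/
theorem right_mem_flatDual_four {c : K ⊕ K → ZMod 2} (hc : c ∈ dualCode (polarityCode π)) :
    c ∘ Sum.inr ∈ flatDual K 4 := by
  intro W hW x
  obtain ⟨U, hU, hk⟩ := exists_le_finrank (U := W) (k := 3) (by omega)
  obtain ⟨v, hv, hvU, hd⟩ := exists_of_finrank_succ hU (by omega)
  have h1 := dotProduct_generator hc hk x
  rw [← dotProduct_generator hc hk (x + v)] at h1
  rw [flat_split hU hv hvU hd, dotProduct_add, add_left_cancel h1]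
  exact add_self_eq_zero_of_binary _

/-- Project to the left half: the image lies in `flatDual K 4`, of dimension at most 1 + 6 + 15 +
20, and the kernel embeds by its right half in `flatDual K 3`, of dimension at most 1 + 6 + 15. -/
theorem finrank_dualCode_polarityCode_le (hK : finrank (ZMod 2) K = 6) :
    finrank (ZMod 2) (dualCode (polarityCode π)) ≤ 64 := by
  let L : (K ⊕ K → ZMod 2) →ₗ[ZMod 2] (K → ZMod 2) := LinearMap.funLeft (ZMod 2) (ZMod 2) Sum.inl
  let R : (K ⊕ K → ZMod 2) →ₗ[ZMod 2] (K → ZMod 2) := LinearMap.funLeft (ZMod 2) (ZMod 2) Sum.inr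
  let P : dualCode (polarityCode π) →ₗ[ZMod 2] flatDual K 4 :=
    L.restrict fun c hc => left_mem_flatDual_four hc
  have hP : ∀ c ∈ LinearMap.ker P, (c : K ⊕ K → ZMod 2) ∘ Sum.inl = 0 := fun c hc =>
    congrArg Subtype.val (LinearMap.mem_ker.1 hc)
  let Q : LinearMap.ker P →ₗ[ZMod 2] flatDual K 3 :=
    LinearMap.codRestrict _ (R ∘ₗ (dualCode (polarityCode π)).subtype ∘ₗ (LinearMap.ker P).subtype)
      fun c => right_mem_flatDual_three c.1.2 (hP _ c.2)
  have hQ : Function.Injective Q := by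
    rw [← LinearMap.ker_eq_bot, LinearMap.ker_eq_bot']
    intro c hc
    have h2 : (c.1.1 : K ⊕ K → ZMod 2) ∘ Sum.inr = 0 := congrArg Subtype.val hc
    refine Subtype.ext (Subtype.ext ?_)
    rw [← Sum.elim_comp_inl_inr (c.1.1 : K ⊕ K → ZMod 2), h2, hP _ c.2]
    funext i
    cases i <;> rfl
  have h1 := LinearMap.finrank_range_add_finrank_ker P
  have h2 := LinearMap.finrank_le_finrank_of_injective hQ
  have h3 := Submodule.finrank_le (LinearMap.range P)
  have h4 := finrank_flatDual_le 6 K hK 4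
  have h5 := finrank_flatDual_le 6 K hK 3
  have e4 : ∑ i ∈ Finset.range 4, Nat.choose 6 i = 42 := by decide
  have e3 : ∑ i ∈ Finset.range 3, Nat.choose 6 i = 22 := by decide
  omega

theorem card_sum_self (hK : finrank (ZMod 2) K = 6) : Fintype.card (K ⊕ K) = 128 := by
  rw [Fintype.card_sum, card_eq_two_pow, hK]
  norm_num

theorem polarityCode_isSelfDual (hπ : IsPolarity π) (hK : finrank (ZMod 2) K = 6) :
    IsSelfDual (polarityCode π) := by
  refine isSelfDual_of_le (selfOrthogonal_span (polarityGenerators_orthogonal hπ hK)) ?_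
  have := finrank_dualCode_polarityCode_le (π := π) hK
  rw [card_sum_self hK]
  omega

theorem polarityCode_eq_dualCode (hπ : IsPolarity π) (hK : finrank (ZMod 2) K = 6) :
    dualCode (polarityCode π) = polarityCode π := polarityCode_isSelfDual hπ hK

end PolarityCode

/-! ### Words of weight at most 20 in the polarity code -/

section SmallWeights

open Module
open scoped Classical

variable {K : Type*} [AddCommGroup K] [Module (ZMod 2) K] [Fintype K]

omit [Fintype K] in
theorem finrank_comap_inl_add_one [Finite K] (U : Submodule (ZMod 2) (K × ZMod 2)) :
    finrank (ZMod 2) U ≤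
      finrank (ZMod 2) (U.comap (LinearMap.inl (ZMod 2) K (ZMod 2))) + 1 := by
  have h1 := Submodule.finrank_sup_add_finrank_inf_eq
    (LinearMap.range (LinearMap.inl (ZMod 2) K (ZMod 2))) U
  rw [← Submodule.map_comap_eq, ← (Submodule.equivMapOfInjective _ LinearMap.inl_injective _).finrank_eq,
    LinearMap.finrank_range_of_inj LinearMap.inl_injective] at h1
  have h2 := Submodule.finrank_le (LinearMap.range (LinearMap.inl (ZMod 2) K (ZMod 2)) ⊔ U)
  rw [finrank_prod, finrank_self] at h2
  omega

/-- Extension by zero from a hyperplane. -/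
theorem extend_mem_flatDual {j : ℕ} {h : K → ZMod 2} (hh : h ∈ flatDual K j) :
    (fun p : K × ZMod 2 => if p.2 = 0 then h p.1 else 0) ∈ flatDual (K × ZMod 2) (j + 1) := by
  rintro U hU ⟨k, z⟩
  have hdim := finrank_comap_inl_add_one U
  have hs : (fun p : K × ZMod 2 => if p.2 = 0 then h p.1 else 0) ⬝ᵥ flat U (k, z) =
      ∑ l, h l * flat U (k, z) (l, 0) := by
    rw [dotProduct, Fintype.sum_prod_type]
    refine Finset.sum_congr rfl fun l _ => ?_
    rw [Fintype.sum_eq_single (0 : ZMod 2)]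
    · rw [if_pos rfl]
    · intro w hw
      rw [if_neg hw, zero_mul]
  rw [hs]
  -- The slice of the flat by `K × {0}` is empty or a flat of dimension at least `j`.
  by_cases hne : ∃ l₀ : K, ((l₀, 0) - (k, z) : K × ZMod 2) ∈ U
  · obtain ⟨l₀, hl₀⟩ := hne
    have : ∀ l, flat U (k, z) (l, 0) = flat (U.comap (LinearMap.inl (ZMod 2) K (ZMod 2))) l₀ l := by
      intro l
      have e : ((l, 0) - (k, z) : K × ZMod 2) ∈ U ↔
          l - l₀ ∈ U.comap (LinearMap.inl (ZMod 2) K (ZMod 2)) := by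
        rw [Submodule.mem_comap, LinearMap.inl_apply]
        have : ((l, 0) - (k, z) : K × ZMod 2) = (l - l₀, 0) + ((l₀, 0) - (k, z)) := by
          ext <;> simp
        rw [this, Submodule.add_mem_iff_left _ hl₀]
      simp only [flat, e]
    simp only [this]
    exact flatDual_mono (by omega) hh _ rfl l₀
  · push Not at hne
    refine Finset.sum_eq_zero fun l _ => ?_
    rw [flat, if_neg (hne l), mul_zero]

/-- Glue `a` and the flat as the two layers of a function on `K × ZMod 2`. It is a 4-flat (the flat
repeated on both layers) plus a function of `flatDual K 3` placed on one layer, hence lies in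
`flatDual (K × ZMod 2) 4`; there weight 12 + 8 is impossible. -/
theorem hammingNorm_ne_twelve (hK : finrank (ZMod 2) K = 6) {a : K → ZMod 2}
    {Q : Submodule (ZMod 2) K} (hQ : finrank (ZMod 2) Q = 3) {x : K}
    (ha : a + flat Q x ∈ flatDual K 3) : hammingNorm a ≠ 12 := by
  intro hw
  set f : K × ZMod 2 → ZMod 2 := fun p => if p.2 = 0 then a p.1 else flat Q x p.1 with hf
  have hdim : finrank (ZMod 2) (K × ZMod 2) = 7 := by rw [finrank_prod, finrank_self, hK]
  have hQ' : finrank (ZMod 2) (Q.comap (LinearMap.fst (ZMod 2) K (ZMod 2))) = 4 := by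
    have h1 := LinearMap.finrank_range_add_finrank_ker
      ((Q.mkQ).comp (LinearMap.fst (ZMod 2) K (ZMod 2)))
    have h2 : LinearMap.range ((Q.mkQ).comp (LinearMap.fst (ZMod 2) K (ZMod 2))) = ⊤ :=
      LinearMap.range_eq_top.2 (Q.mkQ_surjective.comp LinearMap.fst_surjective)
    have h3 := Submodule.finrank_quotient_add_finrank Q
    rw [LinearMap.ker_comp, Submodule.ker_mkQ, h2, finrank_top, hdim] at h1
    omega
  have hfm : f ∈ flatDual (K × ZMod 2) 4 := by
    have : f = (fun p : K × ZMod 2 => if p.2 = 0 then (a + flat Q x) p.1 else 0) +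
        flat (Q.comap (LinearMap.fst (ZMod 2) K (ZMod 2))) (x, 0) := by
      funext p
      have e : flat (Q.comap (LinearMap.fst (ZMod 2) K (ZMod 2))) (x, 0) p = flat Q x p.1 := by
        simp only [flat, Submodule.mem_comap, LinearMap.fst_apply, Prod.fst_sub]
      rw [Pi.add_apply, e, hf]
      by_cases hp : p.2 = 0
      · simp only [if_pos hp, Pi.add_apply, add_assoc, add_self_eq_zero_of_binary, add_zero]
      · simp only [if_neg hp, zero_add]
    rw [this]
    exact (flatDual _ 4).add_mem (extend_mem_flatDual ha) (flat_mem_flatDual (by omega) _)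
  refine hammingNorm_ne_twenty 7 _ hdim 4 rfl f hfm ?_
  have hsum : hammingNorm f = hammingNorm a + hammingNorm (flat Q x) := by
    simp only [hammingNorm, Finset.card_filter, Fintype.sum_prod_type, ← Finset.sum_add_distrib]
    refine Finset.sum_congr rfl fun k _ => ?_
    have : (Finset.univ : Finset (ZMod 2)) = {0, 1} := by decide
    rw [this, Finset.sum_pair zero_ne_one]
    simp [hf]
  rw [hsum, hw, hammingNorm_flat, hQ]
  norm_num

variable {π : Submodule (ZMod 2) K → Submodule (ZMod 2) K}

theorem left_add_flat_mem (hπ : IsPolarity π) (hK : finrank (ZMod 2) K = 6)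
    {c : K ⊕ K → ZMod 2} (hc : c ∈ polarityCode π) {U : Submodule (ZMod 2) K}
    (hU : finrank (ZMod 2) U = 3) {x : K} (hx : c ∘ Sum.inr = flat U x) :
    c ∘ Sum.inl + flat (π U) 0 ∈ flatDual K 3 := by
  have hg : c + Sum.elim (flat (π U) 0) (flat U x) ∈ polarityCode π :=
    (polarityCode π).add_mem hc (Submodule.subset_span (Or.inr ⟨U, x, hU, rfl⟩))
  rw [← polarityCode_eq_dualCode hπ hK] at hg
  refine left_mem_flatDual_three hπ hK hg ?_
  show c ∘ Sum.inr + flat U x = 0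
  rw [hx]
  exact add_self_eq_zero_of_binary _

/-- No generator need have the translate `x + Q` as its left half, so nothing can be subtracted
directly. The dual relations are used instead: they see only the direction `Q`, and `π` carries the
product with `π U` to a product of `π Q` with `U`. -/
theorem right_add_flat_mem (hπ : IsPolarity π) (hK : finrank (ZMod 2) K = 6)
    {c : K ⊕ K → ZMod 2} (hc : c ∈ polarityCode π) {Q : Submodule (ZMod 2) K}
    (hQ : finrank (ZMod 2) Q = 3) {x : K} (hx : c ∘ Sum.inl = flat Q x) :
    c ∘ Sum.inr + flat (π Q) 0 ∈ flatDual K 3 := by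
  intro U hU y
  rw [← polarityCode_eq_dualCode hπ hK] at hc
  have h1 := dotProduct_generator hc hU y
  have h2 := hπ.finrank_eq_three hK hQ
  have h3 := hπ.finrank_eq_three hK hU
  rw [hx] at h1
  rw [add_dotProduct, ← hπ.flat_dotProduct_flat (by omega) x 0 0 y, hπ.2, add_comm, h1]

theorem le_hammingNorm_of_flatDual_four (hK : finrank (ZMod 2) K = 6) {a : K → ZMod 2}
    (ha : a ∈ flatDual K 4) (h0 : a ≠ 0) : 8 ≤ hammingNorm a :=
  le_hammingNorm_of_mem_flatDual 6 K hK 4 a ha h0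

theorem le_hammingNorm_of_flatDual_three (hK : finrank (ZMod 2) K = 6) {a : K → ZMod 2}
    (ha : a ∈ flatDual K 3) (h0 : a ≠ 0) : 16 ≤ hammingNorm a :=
  le_hammingNorm_of_mem_flatDual 6 K hK 3 a ha h0

theorem le_hammingNorm_polarityCode (hπ : IsPolarity π) (hK : finrank (ZMod 2) K = 6)
    {c : K ⊕ K → ZMod 2} (hc : c ∈ polarityCode π) (h0 : c ≠ 0) : 16 ≤ hammingNorm c := by
  rw [← polarityCode_eq_dualCode hπ hK] at hc
  rw [hammingNorm_eq_add]
  by_cases ha : c ∘ Sum.inl = 0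
  · have hb : c ∘ Sum.inr ≠ 0 := by
      intro hb
      apply h0
      rw [← Sum.elim_comp_inl_inr c, ha, hb]
      funext i
      cases i <;> rfl
    have := le_hammingNorm_of_flatDual_three hK (right_mem_flatDual_three hc ha) hb
    omega
  · by_cases hb : c ∘ Sum.inr = 0
    · have := le_hammingNorm_of_flatDual_three hK (left_mem_flatDual_three hπ hK hc hb) ha
      omega
    · have h1 := le_hammingNorm_of_flatDual_four hK (left_mem_flatDual_four hc) ha
      have h2 := le_hammingNorm_of_flatDual_four hK (right_mem_flatDual_four hc) hb
      omega

/-- If one half is zero, the other lies in `flatDual K 3`, which has no words of weight 20.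
Otherwise the halves are even, at least 8 and not 10 on the left, leaving 8 + 12 and 12 + 8; the
half of weight 8 is a flat and excludes weight 12 for the other. -/
theorem hammingNorm_ne_twenty_polarityCode (hπ : IsPolarity π) (hK : finrank (ZMod 2) K = 6)
    {c : K ⊕ K → ZMod 2} (hc : c ∈ polarityCode π) : hammingNorm c ≠ 20 := by
  have hc' := hc
  rw [← polarityCode_eq_dualCode hπ hK] at hc'
  intro hw
  rw [hammingNorm_eq_add] at hw
  by_cases ha : c ∘ Sum.inl = 0
  · rw [ha, hammingNorm_zero, zero_add] at hw
    exact hammingNorm_ne_twenty 6 K hK 3 rfl _ (right_mem_flatDual_three hc' ha) hw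
  · by_cases hb : c ∘ Sum.inr = 0
    · rw [hb, hammingNorm_zero, add_zero] at hw
      exact hammingNorm_ne_twenty 6 K hK 3 rfl _ (left_mem_flatDual_three hπ hK hc' hb) hw
    · have ha4 := left_mem_flatDual_four hc'
      have hb4 := right_mem_flatDual_four hc'
      have h1 := le_hammingNorm_of_flatDual_four hK ha4 ha
      have h2 := le_hammingNorm_of_flatDual_four hK hb4 hb
      have h3 := hammingNorm_ne_ten 6 K hK 4 rfl _ ha4
      obtain ⟨k, hk⟩ := even_hammingNorm_of_mem_flatDual (by omega) ha4
      rcases (by omega : hammingNorm (c ∘ Sum.inl) = 8 ∨ hammingNorm (c ∘ Sum.inl) = 12) with h | h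
      · obtain ⟨Q, x, hQ, hx⟩ := exists_flat_of_hammingNorm_eq 6 K hK 4 (by norm_num) _ ha4 h
        refine hammingNorm_ne_twelve hK (hπ.finrank_eq_three hK hQ)
          (right_add_flat_mem hπ hK hc hQ hx) (by omega)
      · obtain ⟨U, x, hU, hx⟩ := exists_flat_of_hammingNorm_eq 6 K hK 4 (by norm_num) _ hb4
          (by omega : _ = 8)
        exact hammingNorm_ne_twelve hK (hπ.finrank_eq_three hK hU)
          (left_add_flat_mem hπ hK hc hU hx) h

theorem mem_polarityCode_of_orthogonal (hπ : IsPolarity π) (hK : finrank (ZMod 2) K = 6)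
    {a b : K → ZMod 2}
    (h1 : ∀ W : Submodule (ZMod 2) K, finrank (ZMod 2) W = 4 → a ⬝ᵥ flat W 0 = 0)
    (h2 : ∀ (U : Submodule (ZMod 2) K) (x : K), finrank (ZMod 2) U = 3 →
      a ⬝ᵥ flat (π U) 0 + b ⬝ᵥ flat U x = 0) : Sum.elim a b ∈ polarityCode π := by
  rw [← polarityCode_eq_dualCode hπ hK]
  intro c hc
  induction hc using Submodule.span_induction with
  | mem c hc =>
    rcases hc with ⟨W, hW, rfl⟩ | ⟨U, x, hU, rfl⟩
    · rw [sumElim_dotProduct_sumElim, h1 W hW, dotProduct_zero, add_zero]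
    · rw [sumElim_dotProduct_sumElim, h2 U x hU]
  | zero => exact dotProduct_zero _
  | add a b _ _ ha hb => rw [dotProduct_add, ha, hb, add_zero]
  | smul r a _ ha => rw [dotProduct_smul, ha, smul_zero]

/-- Membership forces `Q` and `π U` to have the same products with every 3-space `R`. If they
differed, a complement `R` of `Q` through a vector `q` of `π U` outside `Q` would give 1 against 0.
-/
theorem eq_polarity_of_mem (hπ : IsPolarity π) (hK : finrank (ZMod 2) K = 6)
    {Q U : Submodule (ZMod 2) K} (hQ : finrank (ZMod 2) Q = 3) (hU : finrank (ZMod 2) U = 3)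
    {x y : K} (h : Sum.elim (flat Q x) (flat U y) ∈ polarityCode π) : Q = π U := by
  rw [← polarityCode_eq_dualCode hπ hK] at h
  have hP := hπ.finrank_eq_three hK hU
  have key : ∀ R : Submodule (ZMod 2) K, finrank (ZMod 2) R = 3 →
      flat Q x ⬝ᵥ flat R 0 = flat (π U) 0 ⬝ᵥ flat R 0 := by
    intro R hR
    have h1 := dotProduct_generator h (hπ.finrank_eq_three hK hR) 0
    have h2 := hπ.finrank_eq_three hK hR
    rw [hπ.2] at h1
    have h3 := hπ.flat_dotProduct_flat (U := U) (U' := π R) (by omega) 0 0 y 0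
    rw [hπ.2] at h3
    rw [h3]
    have h4 : flat Q x ⬝ᵥ flat R 0 + flat U y ⬝ᵥ flat (π R) 0 = 0 := h1
    rw [← add_self_eq_zero_of_binary (flat U y ⬝ᵥ flat (π R) 0)] at h4
    exact add_right_cancel h4
  by_contra hne
  obtain ⟨q, hqP, hqQ⟩ : ∃ q ∈ π U, q ∉ Q := by
    by_contra! hcon
    exact hne (Submodule.eq_of_le_of_finrank_eq hcon (by omega)).symm
  have hd : Disjoint (Submodule.span (ZMod 2) {q}) Q := by
    rw [Submodule.disjoint_def]
    intro w hw hwQ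
    obtain ⟨c, rfl⟩ := Submodule.mem_span_singleton.1 hw
    rcases zmod_two_cases c with rfl | rfl
    · exact zero_smul _ _
    · exact absurd (by simpa using hwQ) hqQ
  obtain ⟨R, hR, hc⟩ := hd.exists_isCompl
  have hqR : q ∈ R := hR (Submodule.mem_span_singleton_self q)
  have hq0 : q ≠ 0 := fun h0 => hqQ (h0 ▸ Q.zero_mem)
  have hR3 : finrank (ZMod 2) R = 3 := by
    have := Submodule.finrank_add_eq_of_isCompl hc
    omega
  have h5 := key R hR3
  rw [flat_dotProduct_flat_of_isCompl hc.symm, flat_dotProduct_flat_eq_zero hq0 hqP hqR] at h5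
  exact one_ne_zero h5

/-- With one zero half the other is a minimum word of `flatDual K 3`, a 4-flat. With two nonzero
halves each has the minimum weight 8 of `flatDual K 4`, so both are 3-flats with polar directions;
the two translates are independent. -/
theorem weight_sixteen_polarityCode (hπ : IsPolarity π) (hK : finrank (ZMod 2) K = 6) :
    {c | c ∈ polarityCode π ∧ hammingNorm c = 16} =
      ((fun a => (Sum.elim a 0 : K ⊕ K → ZMod 2)) '' {f : K → ZMod 2 | ∃ (W : Submodule (ZMod 2) K) (x : K),
        finrank (ZMod 2) W = 4 ∧ f = flat W x} ∪
      (fun b => (Sum.elim 0 b : K ⊕ K → ZMod 2)) '' {f : K → ZMod 2 | ∃ (W : Submodule (ZMod 2) K) (x : K),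
        finrank (ZMod 2) W = 4 ∧ f = flat W x}) ∪
      {c | ∃ (U : Submodule (ZMod 2) K) (x y : K), finrank (ZMod 2) U = 3 ∧
        c = Sum.elim (flat (π U) x) (flat U y)} := by
  ext c
  constructor
  · rintro ⟨hc, hw⟩
    have hc' := hc
    rw [← polarityCode_eq_dualCode hπ hK] at hc'
    rw [hammingNorm_eq_add] at hw
    by_cases ha : c ∘ Sum.inl = 0
    · rw [ha, hammingNorm_zero, zero_add] at hw
      obtain ⟨W, x, hW, hx⟩ := exists_flat_of_hammingNorm_eq 6 K hK 3 (by norm_num) _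
        (right_mem_flatDual_three hc' ha) hw
      refine Or.inl (Or.inr ⟨_, ⟨W, x, hW, rfl⟩, ?_⟩)
      rw [← hx, ← ha]
      exact Sum.elim_comp_inl_inr c
    · by_cases hb : c ∘ Sum.inr = 0
      · rw [hb, hammingNorm_zero, add_zero] at hw
        obtain ⟨W, x, hW, hx⟩ := exists_flat_of_hammingNorm_eq 6 K hK 3 (by norm_num) _
          (left_mem_flatDual_three hπ hK hc' hb) hw
        refine Or.inl (Or.inl ⟨_, ⟨W, x, hW, rfl⟩, ?_⟩)
        rw [← hx, ← hb]
        exact Sum.elim_comp_inl_inr c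
      · have ha4 := left_mem_flatDual_four hc'
        have hb4 := right_mem_flatDual_four hc'
        have h1 := le_hammingNorm_of_flatDual_four hK ha4 ha
        have h2 := le_hammingNorm_of_flatDual_four hK hb4 hb
        obtain ⟨Q, x, hQ, hx⟩ := exists_flat_of_hammingNorm_eq 6 K hK 4 (by norm_num) _ ha4
          (by omega : _ = 8)
        obtain ⟨U, y, hU, hy⟩ := exists_flat_of_hammingNorm_eq 6 K hK 4 (by norm_num) _ hb4
          (by omega : _ = 8)
        have hcx : c = Sum.elim (flat Q x) (flat U y) := by
          rw [← hx, ← hy]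
          exact (Sum.elim_comp_inl_inr c).symm
        rw [hcx] at hc
        exact Or.inr ⟨U, x, y, hU, by rw [hcx, eq_polarity_of_mem hπ hK hQ hU hc]⟩
  · rintro ((⟨_, ⟨W, x, hW, rfl⟩, rfl⟩ | ⟨_, ⟨W, x, hW, rfl⟩, rfl⟩) | ⟨U, x, y, hU, rfl⟩)
    · refine ⟨mem_polarityCode_of_orthogonal hπ hK ?_ ?_, ?_⟩
      · intro W' hW'
        exact flat_dotProduct_flat_of_finrank_lt (by omega) _ _
      · intro U y hU
        have := hπ.finrank_eq_three hK hU
        rw [zero_dotProduct, add_zero]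
        exact flat_dotProduct_flat_of_finrank_lt (by omega) _ _
      · show hammingNorm (Sum.elim _ _) = 16
        rw [hammingNorm_sumElim, hammingNorm_flat, hW, hammingNorm_zero]
        norm_num
    · refine ⟨mem_polarityCode_of_orthogonal hπ hK ?_ ?_, ?_⟩
      · exact fun W' hW' => zero_dotProduct _
      · intro U y hU
        rw [zero_dotProduct, zero_add]
        exact flat_dotProduct_flat_of_finrank_lt (by omega) _ _
      · show hammingNorm (Sum.elim _ _) = 16
        rw [hammingNorm_sumElim, hammingNorm_flat, hW, hammingNorm_zero]
        norm_num
    · have hU3 := hπ.finrank_eq_three hK hU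
      refine ⟨mem_polarityCode_of_orthogonal hπ hK ?_ ?_, ?_⟩
      · intro W' hW'
        exact flat_dotProduct_flat_of_finrank_lt (by omega) _ _
      · intro U' z hU'
        rw [hπ.flat_dotProduct_flat (by omega) x 0 y z]
        exact add_self_eq_zero_of_binary _
      · rw [hammingNorm_sumElim, hammingNorm_flat, hammingNorm_flat, hU, hU3]
        norm_num

theorem flat_ne_zero (U : Submodule (ZMod 2) K) (x : K) : flat U x ≠ 0 := by
  rw [← hammingNorm_pos_iff, hammingNorm_flat]
  positivity

theorem ncard_flat_pairs (hπ : IsPolarity π) (hK : finrank (ZMod 2) K = 6) :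
    {c : K ⊕ K → ZMod 2 | ∃ (U : Submodule (ZMod 2) K) (x y : K), finrank (ZMod 2) U = 3 ∧
        c = Sum.elim (flat (π U) x) (flat U y)}.ncard = 1395 * 64 := by
  let F : (Σ U : {W : Submodule (ZMod 2) K // finrank (ZMod 2) W = 3}, (K ⧸ π U.1) × (K ⧸ U.1)) →
      K ⊕ K → ZMod 2 :=
    fun p => Sum.elim (flatOfQuotient (π p.1.1) p.2.1) (flatOfQuotient p.1.1 p.2.2)
  have hF : Function.Injective F := by
    rintro ⟨⟨U, hU⟩, q, r⟩ ⟨⟨U', hU'⟩, q', r'⟩ h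
    obtain ⟨h1, h2⟩ := Sum.elim_eq_iff.1 h
    obtain rfl : U = U' := flat_inj h2
    obtain rfl : q = q' := flatOfQuotient_injective _ h1
    obtain rfl : r = r' := flatOfQuotient_injective _ h2
    rfl
  have hr : {c : K ⊕ K → ZMod 2 | ∃ (U : Submodule (ZMod 2) K) (x y : K), finrank (ZMod 2) U = 3 ∧
        c = Sum.elim (flat (π U) x) (flat U y)} = Set.range F := by
    ext c
    constructor
    · rintro ⟨U, x, y, hU, rfl⟩
      refine ⟨⟨⟨U, hU⟩, (π U).mkQ x, U.mkQ y⟩, ?_⟩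
      show Sum.elim (flatOfQuotient (π U) _) (flatOfQuotient U _) = _
      rw [flatOfQuotient_mk, flatOfQuotient_mk]
    · rintro ⟨⟨⟨U, hU⟩, q, r⟩, rfl⟩
      exact ⟨U, _, _, hU, rfl⟩
  have := fun U : Submodule (ZMod 2) K => Finite.of_surjective _ U.mkQ_surjective
  rw [hr, ← Nat.card_coe_set_eq, Nat.card_range_of_injective hF, Nat.card_sigma]
  have h2 : ∀ U : {W : Submodule (ZMod 2) K // finrank (ZMod 2) W = 3},
      Nat.card ((K ⧸ π U.1) × (K ⧸ U.1)) = 64 := fun U => by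
    rw [Nat.card_prod, card_quotient, card_quotient, U.2, hπ.finrank_eq_three hK U.2, hK]
    norm_num
  simp only [h2, Finset.sum_const, Finset.card_univ, smul_eq_mul]
  rw [← Nat.card_eq_fintype_card, card_subspaces_six_three hK]

theorem weightDistribution_polarityCode_sixteen (hπ : IsPolarity π)
    (hK : finrank (ZMod 2) K = 6) : weightDistribution (polarityCode π) 16 = 94488 := by
  have hinl : Function.Injective fun a : K → ZMod 2 => (Sum.elim a 0 : K ⊕ K → ZMod 2) :=
    fun a a' h => (Sum.elim_eq_iff.1 h).1
  have hinr : Function.Injective fun b : K → ZMod 2 => (Sum.elim 0 b : K ⊕ K → ZMod 2) :=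
    fun a a' h => (Sum.elim_eq_iff.1 h).2
  rw [weightDistribution, weight_sixteen_polarityCode hπ hK, Set.ncard_union_eq,
    Set.ncard_union_eq, Set.ncard_image_of_injective _ hinl, Set.ncard_image_of_injective _ hinr,
    ncard_flats, card_subspaces_six_four hK, hK, ncard_flat_pairs hπ hK]
  -- The total is 651·4 + 651·4 + 1395·64.
  · norm_num
  · rw [Set.disjoint_left]
    rintro _ ⟨_, ⟨W, x, _, rfl⟩, rfl⟩ ⟨_, ⟨W', x', _, rfl⟩, h⟩
    exact flat_ne_zero W x (Sum.elim_eq_iff.1 h).1.symm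
  · rw [Set.disjoint_left]
    rintro _ (⟨_, ⟨W, x, _, rfl⟩, rfl⟩ | ⟨_, ⟨W, x, _, rfl⟩, rfl⟩) ⟨U, y, z, _, h⟩
    · exact flat_ne_zero U z (Sum.elim_eq_iff.1 h).2.symm
    · exact flat_ne_zero (π U) y (Sum.elim_eq_iff.1 h).1.symm

end SmallWeights

/-! ### The third-order Reed–Muller code of length 128 -/

section ReedMuller

open Module
open scoped Classical

variable {m : ℕ}

/-- The value vector of the squarefree monomial with variables in `S`. -/
def monomialVector (S : Finset (Fin m)) : (Fin m → ZMod 2) → ZMod 2 := fun x => ∏ i ∈ S, x i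

theorem monomialVector_mem_reedMuller {r : ℕ} {S : Finset (Fin m)} (hS : S.card ≤ r) :
    monomialVector S ∈ reedMuller r m := by
  refine ⟨∏ i ∈ S, MvPolynomial.X i, ?_, ?_⟩
  · rw [SetLike.mem_coe, MvPolynomial.mem_restrictTotalDegree]
    refine (MvPolynomial.totalDegree_finsetProd _ _).trans ?_
    simpa using hS
  · funext x
    simp [monomialVector]

/-- Every positive power of a binary value equals the value, so a monomial acts as the squarefree
monomial on its support. -/
theorem reedMuller_eq_span (r : ℕ) : reedMuller r m =
    Submodule.span (ZMod 2) {f | ∃ S : Finset (Fin m), S.card ≤ r ∧ f = monomialVector S} := by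
  apply le_antisymm
  · rintro _ ⟨p, hp, rfl⟩
    rw [SetLike.mem_coe, MvPolynomial.mem_restrictTotalDegree] at hp
    rw [p.as_sum, map_sum]
    refine Submodule.sum_mem _ fun s hs => ?_
    have : (LinearMap.pi fun x => (MvPolynomial.aeval x).toLinearMap)
        (MvPolynomial.monomial s (MvPolynomial.coeff s p)) =
        MvPolynomial.coeff s p • monomialVector s.support := by
      funext x
      simp only [LinearMap.pi_apply, AlgHom.toLinearMap_apply, MvPolynomial.aeval_monomial,
        Pi.smul_apply, smul_eq_mul, monomialVector, Algebra.algebraMap_self, RingHom.id_apply]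
      congr 1
      refine Finset.prod_congr rfl fun i hi => ?_
      have hi0 := Finsupp.mem_support_iff.1 hi
      rcases zmod_two_cases (x i) with h | h
      · simp [h, hi0]
      · simp [h]
    rw [this]
    refine Submodule.smul_mem _ _ (Submodule.subset_span ⟨s.support, ?_, rfl⟩)
    refine le_trans ?_ ((MvPolynomial.le_totalDegree hs).trans hp)
    rw [Finset.card_eq_sum_ones]
    exact Finset.sum_le_sum fun i hi => Nat.one_le_iff_ne_zero.2 (Finsupp.mem_support_iff.1 hi)
  · rw [Submodule.span_le]
    rintro _ ⟨S, hS, rfl⟩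
    exact monomialVector_mem_reedMuller hS

theorem monomialVector_periodic {S : Finset (Fin m)} {v : Fin m → ZMod 2}
    (hv : ∀ i ∈ S, v i = 0) (x : Fin m → ZMod 2) :
    monomialVector S (x + v) = monomialVector S x :=
  Finset.prod_congr rfl fun i hi => by rw [Pi.add_apply, hv i hi, add_zero]

theorem monomialVector_dotProduct {S T : Finset (Fin m)} (h : S.card + T.card < m) :
    monomialVector S ⬝ᵥ monomialVector T = 0 := by
  obtain ⟨i, hi⟩ : ∃ i, i ∉ S ∪ T := by
    by_contra! hcon
    have h1 := Finset.card_union_le S T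
    rw [Finset.eq_univ_iff_forall.2 hcon, Finset.card_univ, Fintype.card_fin] at h1
    omega
  rw [Finset.notMem_union] at hi
  have hne : ∀ A : Finset (Fin m), i ∉ A → ∀ k ∈ A, (Pi.single i 1 : Fin m → ZMod 2) k = 0 :=
    fun A hA k hk => Pi.single_eq_of_ne (by rintro rfl; exact hA hk) _
  refine sum_eq_zero_of_periodic _ (Pi.single i 1) (by simp) fun x => ?_
  rw [monomialVector_periodic (hne S hi.1), monomialVector_periodic (hne T hi.2)]

theorem hammingNorm_monomialVector (S : Finset (Fin m)) :
    hammingNorm (monomialVector S) = 2 ^ (m - S.card) := by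
  have : (Finset.univ.filter fun x : Fin m → ZMod 2 => monomialVector S x ≠ 0) =
      Fintype.piFinset fun i => if i ∈ S then ({1} : Finset (ZMod 2)) else Finset.univ := by
    ext x
    simp only [Finset.mem_filter, Finset.mem_univ, true_and, Fintype.mem_piFinset, monomialVector,
      Finset.prod_ne_zero_iff]
    refine forall_congr' fun i => ?_
    by_cases hi : i ∈ S
    · rcases zmod_two_cases (x i) with h | h <;> simp [hi, h]
    · simp [hi]
  rw [hammingNorm, this, Fintype.card_piFinset]
  simp only [apply_ite Finset.card, Finset.card_singleton, Finset.card_univ, ZMod.card]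
  rw [Finset.prod_ite, Finset.prod_const_one, one_mul, Finset.prod_const]
  congr 1
  rw [← Finset.compl_filter, Finset.card_compl, Fintype.card_fin]
  simp

/-- Evaluation at the indicator of `T` sees only the monomials with `S ⊆ T`, so the system is
triangular for inclusion. -/
theorem linearIndependent_monomialVector :
    LinearIndependent (ZMod 2) fun S : Finset (Fin m) => monomialVector S := by
  rw [Fintype.linearIndependent_iff]
  intro g hg
  have heval : ∀ S T : Finset (Fin m),
      monomialVector S (fun i => if i ∈ T then 1 else 0) = if S ⊆ T then 1 else 0 := by
    intro S T
    rw [monomialVector, Finset.prod_ite_zero]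
    simp [Finset.subset_iff]
  intro T
  induction T using Finset.strongInduction with
  | H T ih =>
    have h := congrFun hg (fun i => if i ∈ T then 1 else 0)
    rw [Finset.sum_apply, Finset.sum_eq_single T] at h
    · simpa [heval] using h
    · intro S _ hST
      rw [Pi.smul_apply, heval]
      by_cases hs : S ⊆ T
      · rw [ih S (Finset.ssubset_iff_subset_ne.2 ⟨hs, hST⟩), zero_smul]
      · rw [if_neg hs, smul_zero]
    · simp

theorem sixtyFour_le_finrank_reedMuller : 64 ≤ finrank (ZMod 2) (reedMuller 3 7) := by
  have hli : LinearIndependent (ZMod 2) fun S : {S : Finset (Fin 7) // S.card ≤ 3} =>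
      (⟨monomialVector S.1, monomialVector_mem_reedMuller S.2⟩ : reedMuller 3 7) :=
    LinearIndependent.of_comp (reedMuller 3 7).subtype
      (linearIndependent_monomialVector.comp _ Subtype.val_injective)
  have h := hli.fintype_card_le_finrank
  -- This is 1 + 7 + 21 + 35.
  have hc : Fintype.card {S : Finset (Fin 7) // S.card ≤ 3} = 64 := by
    have : (Finset.univ.filter fun S : Finset (Fin 7) => S.card ≤ 3) =
        (Finset.range 4).biUnion fun k => Finset.powersetCard k Finset.univ := by
      ext S
      simp [Finset.mem_powersetCard, Nat.lt_succ_iff]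
    rw [Fintype.card_subtype, this, Finset.card_biUnion]
    · simp only [Finset.card_powersetCard, Finset.card_univ, Fintype.card_fin]
      decide
    · intro i _ j _ hij
      exact Finset.pairwise_disjoint_powersetCard _ hij
  rwa [hc] at h

theorem reedMuller_le_dualCode : reedMuller 3 7 ≤ dualCode (reedMuller 3 7) := by
  rw [reedMuller_eq_span]
  refine selfOrthogonal_span ?_
  rintro _ ⟨S, hS, rfl⟩ _ ⟨T, hT, rfl⟩
  exact monomialVector_dotProduct (by omega)

theorem reedMuller_isDoublyEven : IsDoublyEven (reedMuller 3 7) := by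
  rw [reedMuller_eq_span]
  refine isDoublyEven_span ?_ ?_
  · rintro _ ⟨S, hS, rfl⟩ _ ⟨T, hT, rfl⟩
    exact monomialVector_dotProduct (by omega)
  · rintro _ ⟨S, hS, rfl⟩
    rw [hammingNorm_monomialVector]
    exact pow_dvd_pow 2 (by omega : 2 ≤ 7 - S.card)

theorem card_binary_seven : Fintype.card (Fin 7 → ZMod 2) = 128 := by
  rw [Fintype.card_fun, ZMod.card, Fintype.card_fin]
  norm_num

theorem finrank_binary_seven : finrank (ZMod 2) (Fin 7 → ZMod 2) = 7 := by
  rw [finrank_fintype_fun_eq_card, Fintype.card_fin]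

theorem reedMuller_isSelfDual : IsSelfDual (reedMuller 3 7) := by
  refine isSelfDual_of_le reedMuller_le_dualCode ?_
  have h1 := finrank_add_finrank_dualCode (reedMuller 3 7)
  have h2 := sixtyFour_le_finrank_reedMuller
  rw [card_binary_seven] at h1 ⊢
  omega

/-- A 4-dimensional direction contains a nonzero vector vanishing on the at most three coordinates
of a monomial; translation by it preserves both the monomial and the flat. -/
theorem reedMuller_le_flatDual : reedMuller 3 7 ≤ flatDual (Fin 7 → ZMod 2) 4 := by
  rw [reedMuller_eq_span, Submodule.span_le]
  rintro _ ⟨S, hS, rfl⟩ U hU x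
  let L : (Fin 7 → ZMod 2) →ₗ[ZMod 2] (S → ZMod 2) := LinearMap.funLeft _ _ Subtype.val
  have h1 := LinearMap.finrank_range_add_finrank_ker L
  have h2 := Submodule.finrank_le (LinearMap.range L)
  rw [finrank_fintype_fun_eq_card, Fintype.card_coe] at h2
  rw [finrank_binary_seven] at h1
  obtain ⟨v, hv0, hvU, hv⟩ := exists_mem_inf_of_finrank_lt (U := U) (U' := LinearMap.ker L)
    (by rw [finrank_binary_seven]; omega)
  refine sum_eq_zero_of_periodic _ v hv0 fun y => ?_
  rw [flat_add_of_mem hvU, monomialVector_periodic]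
  exact fun i hi => congrFun (LinearMap.mem_ker.1 hv) ⟨i, hi⟩

theorem flat_mem_reedMuller {U : Submodule (ZMod 2) (Fin 7 → ZMod 2)}
    (hU : finrank (ZMod 2) U = 4) (x : Fin 7 → ZMod 2) : flat U x ∈ reedMuller 3 7 := by
  have h : dualCode (reedMuller 3 7) = reedMuller 3 7 := reedMuller_isSelfDual
  rw [← h]
  intro c hc
  rw [dotProduct_comm]
  exact reedMuller_le_flatDual hc U hU x

theorem le_hammingNorm_reedMuller {c : (Fin 7 → ZMod 2) → ZMod 2} (hc : c ∈ reedMuller 3 7)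
    (h0 : c ≠ 0) : 16 ≤ hammingNorm c :=
  le_hammingNorm_of_mem_flatDual 7 _ finrank_binary_seven 4 c (reedMuller_le_flatDual hc) h0

theorem hammingNorm_ne_twenty_reedMuller {c : (Fin 7 → ZMod 2) → ZMod 2}
    (hc : c ∈ reedMuller 3 7) : hammingNorm c ≠ 20 :=
  hammingNorm_ne_twenty 7 _ finrank_binary_seven 4 rfl c (reedMuller_le_flatDual hc)

theorem weightDistribution_reedMuller_sixteen : weightDistribution (reedMuller 3 7) 16 = 94488 := by
  have : {c | c ∈ reedMuller 3 7 ∧ hammingNorm c = 16} =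
      {f | ∃ (U : Submodule (ZMod 2) (Fin 7 → ZMod 2)) (x : Fin 7 → ZMod 2),
        finrank (ZMod 2) U = 4 ∧ f = flat U x} := by
    ext c
    constructor
    · rintro ⟨hc, hw⟩
      exact exists_flat_of_hammingNorm_eq 7 _ finrank_binary_seven 4 (by norm_num) c
        (reedMuller_le_flatDual hc) hw
    · rintro ⟨U, x, hU, rfl⟩
      exact ⟨flat_mem_reedMuller hU x, by rw [hammingNorm_flat, hU]; norm_num⟩
  rw [weightDistribution, this, ncard_flats, card_subspaces_seven_four finrank_binary_seven,
    finrank_binary_seven]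
  norm_num

end ReedMuller

/-! ### Reduction of the weight distribution to the words of weight 16 -/

section Comparison

variable {ι ι' : Type*} [Fintype ι] [Fintype ι']

theorem weightDistribution_eq_zero {C : Submodule (ZMod 2) (ι → ZMod 2)} {i : ℕ}
    (h : ∀ c ∈ C, hammingNorm c ≠ i) : weightDistribution C i = 0 := by
  rw [weightDistribution, Set.ncard_eq_zero]
  exact Set.eq_empty_of_forall_notMem fun c hc => h c hc.1 hc.2

theorem weightDistribution_zero (C : Submodule (ZMod 2) (ι → ZMod 2)) :
    weightDistribution C 0 = 1 := by
  rw [weightDistribution, Set.ncard_eq_one]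
  refine ⟨0, ?_⟩
  ext c
  simp only [Set.mem_ofPred_eq, hammingNorm_eq_zero, Set.mem_singleton_iff]
  exact ⟨fun h => h.2, fun h => ⟨h ▸ C.zero_mem, h⟩⟩

/-- A doubly-even self-dual code of length 128 with minimum weight at least 16 and without words of
weight 20 has its weight distribution determined by the number of words of weight 16. -/
theorem weightDistribution_eq_of_sixteen {C : Submodule (ZMod 2) (ι → ZMod 2)}
    {C' : Submodule (ZMod 2) (ι' → ZMod 2)} (hι : Fintype.card ι = 128)
    (hι' : Fintype.card ι' = 128) (hC : IsSelfDual C) (hC' : IsSelfDual C')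
    (hd : IsDoublyEven C) (hd' : IsDoublyEven C')
    (hmin : ∀ c ∈ C, c ≠ 0 → 16 ≤ hammingNorm c) (hmin' : ∀ c ∈ C', c ≠ 0 → 16 ≤ hammingNorm c)
    (h20 : ∀ c ∈ C, hammingNorm c ≠ 20) (h20' : ∀ c ∈ C', hammingNorm c ≠ 20)
    (h16 : weightDistribution C 16 = weightDistribution C' 16) (i : ℕ) :
    weightDistribution C i = weightDistribution C' i := by
  refine weightDistribution_eq_of_lt hι hι' hC hC' hd hd' (fun i hi => ?_) i
  rcases Nat.eq_zero_or_pos i with rfl | h0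
  · rw [weightDistribution_zero, weightDistribution_zero]
  · by_cases h4 : 4 ∣ i
    · obtain ⟨k, rfl⟩ := h4
      rcases (by omega : k < 4 ∨ k = 4 ∨ k = 5) with hk | rfl | rfl
      · rw [weightDistribution_eq_zero, weightDistribution_eq_zero]
        · intro c hc hw
          have := hmin' c hc (by rw [← hammingNorm_pos_iff]; omega)
          omega
        · intro c hc hw
          have := hmin c hc (by rw [← hammingNorm_pos_iff]; omega)
          omega
      · exact h16
      · rw [weightDistribution_eq_zero h20, weightDistribution_eq_zero h20']
    · rw [weightDistribution_eq_zero_of_not_dvd hd h4,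
        weightDistribution_eq_zero_of_not_dvd hd' h4]

end Comparison

/-! ### Any two points lie in 155 generators -/

section GeneratorCounts

open Module

variable {K : Type*} [AddCommGroup K] [Module (ZMod 2) K] [Fintype K]
  {π : Submodule (ZMod 2) K → Submodule (ZMod 2) K}

omit [Fintype K] in
theorem flat_apply_eq_one {U : Submodule (ZMod 2) K} {x v : K} : flat U x v = 1 ↔ v - x ∈ U := by
  rw [flat]
  split_ifs with h <;> simp [h]

omit [Fintype K] in
theorem flat_zero_apply_eq_one {U : Submodule (ZMod 2) K} {v : K} : flat U 0 v = 1 ↔ v ∈ U := by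
  rw [flat_apply_eq_one, sub_zero]

theorem card_three_subspaces_ge_polarity (hπ : IsPolarity π) (hK : finrank (ZMod 2) K = 6)
    (L : Submodule (ZMod 2) K) :
    Nat.card {U : Submodule (ZMod 2) K // L ≤ π U ∧ finrank (ZMod 2) U = 3} =
      Nat.card {U : Submodule (ZMod 2) K // L ≤ U ∧ finrank (ZMod 2) U = 3} :=
  Nat.card_congr
    { toFun := fun U => ⟨π U.1, U.2.1, hπ.finrank_eq_three hK U.2.2⟩
      invFun := fun U => ⟨π U.1, by rw [hπ.2]; exact U.2.1, hπ.finrank_eq_three hK U.2.2⟩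
      left_inv := fun U => Subtype.ext (hπ.2 _)
      right_inv := fun U => Subtype.ext (hπ.2 _) }

theorem card_three_subspaces_ge_line (hK : finrank (ZMod 2) K = 6) {v : K} (hv : v ≠ 0) :
    Nat.card {U : Submodule (ZMod 2) K //
      Submodule.span (ZMod 2) {v} ≤ U ∧ finrank (ZMod 2) U = 3} = 155 := by
  have h1 := finrank_span_singleton (K := ZMod 2) hv
  have h2 := card_subspaces_ge (Submodule.span (ZMod 2) {v}) 2
  have h3 := Submodule.finrank_quotient_add_finrank (Submodule.span (ZMod 2) {v})
  have : Finite (K ⧸ Submodule.span (ZMod 2) {v}) :=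
    Finite.of_surjective _ (Submodule.mkQ_surjective _)
  rw [h1, card_subspaces_five_two (by omega)] at h2
  exact h2

theorem finrank_span_pair {v w : K} (hv : v ≠ 0) (hw : w ≠ 0) (hvw : v ≠ w) :
    finrank (ZMod 2) ↥(Submodule.span (ZMod 2) {v} ⊔ Submodule.span (ZMod 2) {w}) = 2 := by
  rw [finrank_sup_span_singleton, finrank_span_singleton hv]
  intro h
  obtain ⟨c, rfl⟩ := Submodule.mem_span_singleton.1 h
  rcases zmod_two_cases c with rfl | rfl
  · exact hw (zero_smul _ _)
  · exact hvw (one_smul _ _).symm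

omit [Fintype K] in
-- Once a generator is required to contain the point `x` of the second copy, its translate is fixed
-- and `U` determines it.
theorem ncard_generators_inr (x : K) (s : Set (Submodule (ZMod 2) K)) :
    {c : K ⊕ K → ZMod 2 | ∃ U ∈ s, c = Sum.elim (flat (π U) 0) (flat U x)}.ncard = s.ncard := by
  have : {c : K ⊕ K → ZMod 2 | ∃ U ∈ s, c = Sum.elim (flat (π U) 0) (flat U x)} =
      (fun U => Sum.elim (flat (π U) 0) (flat U x)) '' s := by
    ext c
    exact exists_congr fun U => and_congr_right fun _ => eq_comm
  rw [this, Set.ncard_image_of_injective]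
  intro U U' h
  exact flat_inj (Sum.elim_eq_iff.1 h).2

theorem ncard_generators_inl_inr (hπ : IsPolarity π) (hK : finrank (ZMod 2) K = 6) {v w : K}
    (hv : v ≠ 0) :
    {c ∈ polarityGenerators π | c (Sum.inl v) = 1 ∧ c (Sum.inr w) = 1}.ncard = 155 := by
  rw [← card_three_subspaces_ge_line hK hv, ← card_three_subspaces_ge_polarity hπ hK]
  refine Eq.trans ?_ (ncard_generators_inr (π := π) w
    {U | Submodule.span (ZMod 2) {v} ≤ π U ∧ finrank (ZMod 2) U = 3})
  congr 1
  ext c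
  constructor
  · rintro ⟨⟨W, hW, rfl⟩ | ⟨U, x, hU, rfl⟩, h1, h2⟩
    · exact absurd h2 zero_ne_one
    · refine ⟨U, ⟨?_, hU⟩, ?_⟩
      · rw [Submodule.span_singleton_le_iff_mem]
        exact flat_zero_apply_eq_one.1 h1
      · rw [flat_eq_iff.2 (flat_apply_eq_one.1 h2)]
  · rintro ⟨U, ⟨h1, hU⟩, rfl⟩
    rw [Submodule.span_singleton_le_iff_mem] at h1
    refine ⟨Or.inr ⟨U, w, hU, rfl⟩, flat_zero_apply_eq_one.2 h1, flat_apply_eq_one.2 ?_⟩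
    rw [sub_self]
    exact U.zero_mem

theorem ncard_generators_inr_inr (hK : finrank (ZMod 2) K = 6) {v w : K} (hvw : v ≠ w) :
    {c ∈ polarityGenerators π | c (Sum.inr v) = 1 ∧ c (Sum.inr w) = 1}.ncard = 155 := by
  rw [← card_three_subspaces_ge_line hK (sub_ne_zero.2 hvw)]
  refine Eq.trans ?_ (ncard_generators_inr (π := π) w
    {U | Submodule.span (ZMod 2) {v - w} ≤ U ∧ finrank (ZMod 2) U = 3})
  congr 1
  ext c
  constructor
  · rintro ⟨⟨W, hW, rfl⟩ | ⟨U, x, hU, rfl⟩, h1, h2⟩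
    · exact absurd h2 zero_ne_one
    · replace h1 := flat_apply_eq_one.1 h1
      replace h2 := flat_apply_eq_one.1 h2
      refine ⟨U, ⟨?_, hU⟩, by rw [flat_eq_iff.2 h2]⟩
      rw [Submodule.span_singleton_le_iff_mem]
      have := U.sub_mem h1 h2
      rwa [sub_sub_sub_cancel_right] at this
  · rintro ⟨U, ⟨h1, hU⟩, rfl⟩
    rw [Submodule.span_singleton_le_iff_mem] at h1
    refine ⟨Or.inr ⟨U, w, hU, rfl⟩, flat_apply_eq_one.2 h1, flat_apply_eq_one.2 ?_⟩
    rw [sub_self]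
    exact U.zero_mem

/-- Generators through two points of the first copy are those containing the 2-space `L` they span:
35 of dimension 4, and 15 choices of `U` with `L ≤ π U`, each with 8 translates, in all 35 + 15·8.
-/
theorem ncard_generators_inl_inl (hπ : IsPolarity π) (hK : finrank (ZMod 2) K = 6) {v w : K}
    (hv : v ≠ 0) (hw : w ≠ 0) (hvw : v ≠ w) :
    {c ∈ polarityGenerators π | c (Sum.inl v) = 1 ∧ c (Sum.inl w) = 1}.ncard = 155 := by
  set L := Submodule.span (ZMod 2) {v} ⊔ Submodule.span (ZMod 2) {w} with hL
  have hL2 : finrank (ZMod 2) L = 2 := finrank_span_pair hv hw hvw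
  have hLle : ∀ U : Submodule (ZMod 2) K, L ≤ U ↔ v ∈ U ∧ w ∈ U := fun U => by
    rw [hL, sup_le_iff, Submodule.span_singleton_le_iff_mem, Submodule.span_singleton_le_iff_mem]
  have hq := Submodule.finrank_quotient_add_finrank L
  have : Finite (K ⧸ L) := Finite.of_surjective _ L.mkQ_surjective
  have hfour : Nat.card {W : Submodule (ZMod 2) K // L ≤ W ∧ finrank (ZMod 2) W = 4} = 35 := by
    rw [← card_subspaces_four_two (V := K ⧸ L) (by omega), ← card_subspaces_ge, hL2]
  have hthree : Nat.card {U : Submodule (ZMod 2) K // L ≤ π U ∧ finrank (ZMod 2) U = 3} = 15 := by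
    rw [card_three_subspaces_ge_polarity hπ hK,
      ← card_subspaces_four_one (V := K ⧸ L) (by omega), ← card_subspaces_ge, hL2]
  let F₁ : {W : Submodule (ZMod 2) K // L ≤ W ∧ finrank (ZMod 2) W = 4} → K ⊕ K → ZMod 2 :=
    fun W => Sum.elim (flat W.1 0) 0
  let F₂ : (Σ U : {U : Submodule (ZMod 2) K // L ≤ π U ∧ finrank (ZMod 2) U = 3}, K ⧸ U.1) →
      K ⊕ K → ZMod 2 := fun p => Sum.elim (flat (π p.1.1) 0) (flatOfQuotient p.1.1 p.2)
  have hF₁ : Function.Injective F₁ := fun W W' h =>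
    Subtype.ext (flat_inj (Sum.elim_eq_iff.1 h).1)
  have hF₂ : Function.Injective F₂ := by
    rintro ⟨⟨U, hU⟩, q⟩ ⟨⟨U', hU'⟩, q'⟩ h
    have h2 := (Sum.elim_eq_iff.1 h).2
    obtain rfl : U = U' := flat_inj h2
    obtain rfl : q = q' := flatOfQuotient_injective U h2
    rfl
  have hset : {c ∈ polarityGenerators π | c (Sum.inl v) = 1 ∧ c (Sum.inl w) = 1} =
      Set.range F₁ ∪ Set.range F₂ := by
    ext c
    constructor
    · rintro ⟨⟨W, hW, rfl⟩ | ⟨U, x, hU, rfl⟩, h1, h2⟩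
      · exact Or.inl ⟨⟨W, (hLle W).2 ⟨flat_zero_apply_eq_one.1 h1, flat_zero_apply_eq_one.1 h2⟩,
          hW⟩, rfl⟩
      · refine Or.inr ⟨⟨⟨U, (hLle _).2 ⟨flat_zero_apply_eq_one.1 h1,
          flat_zero_apply_eq_one.1 h2⟩, hU⟩, U.mkQ x⟩, ?_⟩
        show Sum.elim _ (flatOfQuotient U _) = _
        rw [flatOfQuotient_mk]
    · rintro (⟨⟨W, hLW, hW⟩, rfl⟩ | ⟨⟨⟨U, hLU, hU⟩, q⟩, rfl⟩)
      · exact ⟨Or.inl ⟨W, hW, rfl⟩, flat_zero_apply_eq_one.2 ((hLle W).1 hLW).1,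
          flat_zero_apply_eq_one.2 ((hLle W).1 hLW).2⟩
      · exact ⟨Or.inr ⟨U, _, hU, rfl⟩, flat_zero_apply_eq_one.2 ((hLle _).1 hLU).1,
          flat_zero_apply_eq_one.2 ((hLle _).1 hLU).2⟩
  have hdisj : Disjoint (Set.range F₁) (Set.range F₂) := by
    rw [Set.disjoint_left]
    rintro _ ⟨W, rfl⟩ ⟨⟨U, q⟩, h⟩
    exact flat_ne_zero _ _ (Sum.elim_eq_iff.1 h).2
  have hfin := fun U : Submodule (ZMod 2) K => Finite.of_surjective _ U.mkQ_surjective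
  have := Fintype.ofFinite {U : Submodule (ZMod 2) K // L ≤ π U ∧ finrank (ZMod 2) U = 3}
  have hcard : ∀ U : {U : Submodule (ZMod 2) K // L ≤ π U ∧ finrank (ZMod 2) U = 3},
      Nat.card (K ⧸ U.1) = 8 := fun U => by
    rw [card_quotient, U.2.2, hK]
    norm_num
  rw [hset, Set.ncard_union_eq hdisj, ← Nat.card_coe_set_eq, ← Nat.card_coe_set_eq,
    Nat.card_range_of_injective hF₁, Nat.card_range_of_injective hF₂, hfour, Nat.card_sigma]
  simp only [hcard, Finset.sum_const, Finset.card_univ, smul_eq_mul]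
  rw [← Nat.card_eq_fintype_card, hthree]

/-- The excluded `Sum.inl 0` is the point added by the parity check; it lies in every generator. -/
theorem ncard_generators_pair (hπ : IsPolarity π) (hK : finrank (ZMod 2) K = 6) {s t : K ⊕ K}
    (hst : s ≠ t) (hs : s ≠ Sum.inl 0) (ht : t ≠ Sum.inl 0) :
    {c ∈ polarityGenerators π | c s = 1 ∧ c t = 1}.ncard = 155 := by
  rcases s with v | v <;> rcases t with w | w
  · exact ncard_generators_inl_inl hπ hK (by simpa using hs) (by simpa using ht)
      (by simpa using hst)
  · exact ncard_generators_inl_inr hπ hK (by simpa using hs)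
  · rw [← ncard_generators_inl_inr hπ hK (v := w) (w := v) (by simpa using ht)]
    congr 1
    ext c
    exact and_congr_right fun _ => and_comm
  · exact ncard_generators_inr_inr hK (by simpa using hst)

theorem hammingNorm_generator (hπ : IsPolarity π) (hK : finrank (ZMod 2) K = 6)
    {c : K ⊕ K → ZMod 2} (hc : c ∈ polarityGenerators π) : hammingNorm c = 16 := by
  rcases hc with ⟨W, hW, rfl⟩ | ⟨U, x, hU, rfl⟩
  · rw [hammingNorm_sumElim, hammingNorm_flat, hW, hammingNorm_zero]; norm_num
  · rw [hammingNorm_sumElim, hammingNorm_flat, hammingNorm_flat, hU, hπ.finrank_eq_three hK hU]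
    norm_num

end GeneratorCounts

/-! ### Invariance under renaming coordinates -/

section Reindexing

variable {ι κ : Type*} [Fintype ι] [Fintype κ]

theorem hammingNorm_comp_equiv (e : ι ≃ κ) (c : κ → ZMod 2) :
    hammingNorm (c ∘ e) = hammingNorm c := by
  simp only [hammingNorm, Finset.card_filter]
  exact Equiv.sum_comp e fun k => if c k ≠ 0 then 1 else 0

/-- The code `C` with coordinates renamed along `e`. -/
def reindexCode (e : ι ≃ κ) (C : Submodule (ZMod 2) (κ → ZMod 2)) :
    Submodule (ZMod 2) (ι → ZMod 2) :=
  C.map (LinearMap.funLeft (ZMod 2) (ZMod 2) e)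

omit [Fintype ι] [Fintype κ] in
theorem mem_reindexCode {e : ι ≃ κ} {C : Submodule (ZMod 2) (κ → ZMod 2)} {x : ι → ZMod 2} :
    x ∈ reindexCode e C ↔ x ∘ e.symm ∈ C := by
  constructor
  · rintro ⟨c, hc, rfl⟩
    have : (LinearMap.funLeft (ZMod 2) (ZMod 2) e c) ∘ e.symm = c := by
      funext k
      simp [LinearMap.funLeft_apply]
    rwa [this]
  · intro h
    refine ⟨_, h, ?_⟩
    funext i
    simp [LinearMap.funLeft_apply]

theorem weightDistribution_reindexCode (e : ι ≃ κ) (C : Submodule (ZMod 2) (κ → ZMod 2)) (i : ℕ) :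
    weightDistribution (reindexCode e C) i = weightDistribution C i := by
  refine Set.ncard_congr (fun c _ => c ∘ e.symm) ?_ ?_ ?_
  · rintro c ⟨hc, hw⟩
    exact ⟨mem_reindexCode.1 hc, by rw [hammingNorm_comp_equiv, hw]⟩
  · intro c d _ _ h
    exact e.symm.surjective.injective_comp_right h
  · rintro c ⟨hc, hw⟩
    have h : (c ∘ e) ∘ e.symm = c := by funext k; simp
    exact ⟨c ∘ e, ⟨mem_reindexCode.2 (by rwa [h]), by rw [hammingNorm_comp_equiv, hw]⟩, h⟩

theorem IsDoublyEven.reindexCode {C : Submodule (ZMod 2) (κ → ZMod 2)} (h : IsDoublyEven C)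
    (e : ι ≃ κ) : IsDoublyEven (reindexCode e C) := by
  intro c hc
  have := h _ (mem_reindexCode.1 hc)
  rwa [hammingNorm_comp_equiv] at this

theorem IsSelfDual.reindexCode {C : Submodule (ZMod 2) (κ → ZMod 2)} (h : IsSelfDual C)
    (e : ι ≃ κ) : IsSelfDual (reindexCode e C) := by
  have hC : dualCode C = C := h
  ext x
  rw [mem_reindexCode]
  constructor
  · intro hx
    rw [← hC]
    intro c hc
    have hce : (c ∘ e) ∘ e.symm = c := by funext k; simp
    have := hx (c ∘ e) (mem_reindexCode.2 (by rwa [hce]))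
    rwa [← comp_equiv_symm_dotProduct] at this
  · intro hx c hc
    rw [← hC] at hx
    have := hx _ (mem_reindexCode.1 hc)
    rwa [comp_equiv_dotProduct_comp_equiv] at this

end Reindexing

/-! ### Projective points and the added point as vectors of two cosets -/

section ProjectivePoints

variable {V : Type*} [AddCommGroup V] [Module (ZMod 2) V]

theorem rep_mk_of_binary (v : V) (hv : v ≠ 0) : (Projectivization.mk (ZMod 2) v hv).rep = v := by
  obtain ⟨a, ha⟩ := Projectivization.exists_smul_eq_mk_rep (ZMod 2) v hv
  rw [← ha]
  have : (a : ZMod 2) = 1 := (zmod_two_cases _).resolve_left a.ne_zero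
  rw [Units.smul_def, this, one_smul]

/-- Over `𝔽₂`, adding one point to the projective space gives the vector space. -/
noncomputable def vectorOfPoint (z : Option (ℙ (ZMod 2) V)) : V := z.elim 0 Projectivization.rep

theorem vectorOfPoint_bijective :
    Function.Bijective (vectorOfPoint : Option (ℙ (ZMod 2) V) → V) := by
  constructor
  · rintro (_ | p) (_ | q) h
    · rfl
    · exact absurd h.symm q.rep_nonzero
    · exact absurd h p.rep_nonzero
    · have h' : p.rep = q.rep := h
      have : p = q := by
        rw [← p.mk_rep, ← q.mk_rep]
        simp only [h']
      rw [this]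
  · intro v
    by_cases hv : v = 0
    · exact ⟨none, hv.symm⟩
    · exact ⟨some (Projectivization.mk (ZMod 2) v hv), rep_mk_of_binary v hv⟩

theorem mem_projPoints {W : Submodule (ZMod 2) V} {p : ℙ (ZMod 2) V} :
    p ∈ projPoints W ↔ p.rep ∈ W := by
  have := Submodule.mk_mem_projectivization_iff W p.rep_nonzero
  rwa [p.mk_rep] at this

variable {H : Submodule (ZMod 2) V} {w : V}

/-- The vectors of the hyperplane `H`, and those of its complement `w + H`. -/
def vectorOfPair (H : Submodule (ZMod 2) V) (w : V) : H ⊕ H → V :=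
  Sum.elim (fun h => h) (fun h => w + h)

theorem vectorOfPair_bijective (hw : w ∉ H) (hH : ∀ v, v ∈ H ∨ v - w ∈ H) :
    Function.Bijective (vectorOfPair H w) := by
  have hne : ∀ h h' : H, (h : V) ≠ w + h' := fun h h' he =>
    hw ((Submodule.add_mem_iff_left _ h'.2).1 (he ▸ h.2))
  constructor
  · rintro (h | h) (h' | h') he
    · exact congrArg Sum.inl (Subtype.ext he)
    · exact absurd he (hne h h')
    · exact absurd he.symm (hne h' h)
    · exact congrArg Sum.inr (Subtype.ext (add_left_cancel he))
  · intro v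
    rcases hH v with h | h
    · exact ⟨Sum.inl ⟨v, h⟩, rfl⟩
    · exact ⟨Sum.inr ⟨v - w, h⟩, add_sub_cancel w v⟩

/-- The points of the extended design as two copies of the hyperplane. -/
noncomputable def pointEquiv (hw : w ∉ H) (hH : ∀ v, v ∈ H ∨ v - w ∈ H) :
    Option (ℙ (ZMod 2) V) ≃ H ⊕ H :=
  (Equiv.ofBijective _ vectorOfPoint_bijective).trans
    (Equiv.ofBijective _ (vectorOfPair_bijective hw hH)).symm

theorem vectorOfPair_pointEquiv (hw : w ∉ H) (hH : ∀ v, v ∈ H ∨ v - w ∈ H)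
    (z : Option (ℙ (ZMod 2) V)) :
    vectorOfPair H w (pointEquiv hw hH z) = vectorOfPoint z :=
  Equiv.ofBijective_apply_symm_apply _ (vectorOfPair_bijective hw hH) _

theorem pointEquiv_none (hw : w ∉ H) (hH : ∀ v, v ∈ H ∨ v - w ∈ H) :
    pointEquiv hw hH none = Sum.inl 0 := by
  apply (vectorOfPair_bijective hw hH).injective
  rw [vectorOfPair_pointEquiv]
  rfl

end ProjectivePoints

/-! ### Extended incidence vectors and the extended code -/

section ExtendedWords

variable {P : Type*}

/-- The incidence vector of a set of points, extended by an additional coordinate one. -/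
noncomputable def extendedWord (B : Set P) : Option P → ZMod 2 :=
  fun z => z.elim 1 (B.indicator 1)

theorem extendedWord_some_eq_one {B : Set P} {p : P} : extendedWord B (some p) = 1 ↔ p ∈ B := by
  show B.indicator 1 p = 1 ↔ p ∈ B
  by_cases h : p ∈ B <;> simp [h]

theorem extendedWord_injective : Function.Injective (extendedWord : Set P → Option P → ZMod 2) := by
  intro B B' h
  ext p
  rw [← extendedWord_some_eq_one, h, extendedWord_some_eq_one]

variable [Fintype P]

theorem hammingNorm_extendedWord (B : Set P) : hammingNorm (extendedWord B) = B.ncard + 1 := by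
  classical
  rw [hammingNorm, Finset.card_filter, Fintype.sum_option, ← Finset.card_filter, add_comm,
    Set.ncard_eq_toFinset_card']
  congr 2
  ext p
  by_cases h : p ∈ B <;> simp [extendedWord, h]

/-- If every block has an odd number of points, the extended code is spanned by the extended
incidence vectors. -/
theorem extendedCode_blockCode {𝓑 : Set (Set P)}
    (h𝓑 : ∀ B ∈ 𝓑, ∑ z, extendedWord B z = 0) :
    extendedCode (blockCode 𝓑) = Submodule.span (ZMod 2) (extendedWord '' 𝓑) := by
  have hsome : ∀ B : Set P, (fun p => extendedWord B (some p)) = B.indicator 1 := fun B => rfl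
  have hle : Submodule.span (ZMod 2) (extendedWord '' 𝓑) ≤ extendedCode (blockCode 𝓑) := by
    rw [Submodule.span_le]
    rintro _ ⟨B, hB, rfl⟩
    exact ⟨Submodule.subset_span ⟨B, hB, rfl⟩, h𝓑 B hB⟩
  refine le_antisymm (fun x hx => ?_) hle
  let L : (Option P → ZMod 2) →ₗ[ZMod 2] (P → ZMod 2) := LinearMap.funLeft (ZMod 2) (ZMod 2) some
  have hb : blockCode 𝓑 ≤ (Submodule.span (ZMod 2) (extendedWord '' 𝓑)).map L := by
    rw [blockCode, Submodule.span_le]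
    rintro _ ⟨B, hB, rfl⟩
    exact ⟨extendedWord B, Submodule.subset_span ⟨B, hB, rfl⟩, rfl⟩
  obtain ⟨y, hy, hyx⟩ := hb hx.1
  -- `x` and `y` agree on the original coordinates, and the parity check forces agreement at `none`.
  have hsub := (extendedCode (blockCode 𝓑)).sub_mem hx (hle hy)
  have h0 : ∀ p, (x - y) (some p) = 0 := fun p => sub_eq_zero.2 (congrFun hyx p).symm
  have hn : (x - y) none = 0 := by
    have := hsub.2
    rwa [Fintype.sum_option, Finset.sum_eq_zero fun p _ => h0 p, add_zero] at this
  have : x = y := by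
    rw [← sub_eq_zero]
    funext z
    rcases z with _ | p
    · exact hn
    · exact h0 p
  rwa [this]

end ExtendedWords

/-! ### Extended blocks correspond to the generators -/

section Blocks

open Module

variable {V : Type*} [AddCommGroup V] [Module (ZMod 2) V] [Finite V]
  {H : Submodule (ZMod 2) V} {w : V} {π : Submodule (ZMod 2) H → Submodule (ZMod 2) H}

omit [Finite V] in
theorem extendedWord_eq {B : Set (ℙ (ZMod 2) V)} (hw : w ∉ H) (hH : ∀ v, v ∈ H ∨ v - w ∈ H)
    {c : H ⊕ H → ZMod 2} (h0 : c (Sum.inl 0) = 1)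
    (h : ∀ p s, p.rep = vectorOfPair H w s → (p ∈ B ↔ c s = 1)) :
    extendedWord B = c ∘ pointEquiv hw hH := by
  funext z
  rcases z with _ | p
  · rw [Function.comp_apply, pointEquiv_none, h0]
    rfl
  · have h1 := h p (pointEquiv hw hH (some p)) (vectorOfPair_pointEquiv hw hH (some p)).symm
    rw [← extendedWord_some_eq_one] at h1
    rw [Function.comp_apply]
    rcases zmod_two_cases (c (pointEquiv hw hH (some p))) with h2 | h2
    · rw [h2] at h1 ⊢
      exact (zmod_two_cases _).resolve_right fun h3 => zero_ne_one (h1.1 h3)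
    · rw [h2]
      exact h1.2 h2

omit [Finite V] in
theorem pair_notMem (hw : w ∉ H) (h : H) : w + (h : V) ∉ H := fun hh =>
  hw ((Submodule.add_mem_iff_left _ h.2).1 hh)

omit [Finite V] in
theorem extendedWord_subspace (hw : w ∉ H) (hH : ∀ v, v ∈ H ∨ v - w ∈ H)
    {W : Submodule (ZMod 2) V} (hW : W ≤ H) :
    extendedWord (projPoints W) = Sum.elim (flat (W.submoduleOf H) 0) 0 ∘ pointEquiv hw hH := by
  refine extendedWord_eq hw hH (flat_zero_apply_eq_one.2 (Submodule.zero_mem _)) ?_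
  rintro p (h | h) hp
  · rw [mem_projPoints, hp, Sum.elim_inl, flat_zero_apply_eq_one]
    rfl
  · rw [mem_projPoints, hp, Sum.elim_inr]
    exact ⟨fun hm => absurd (hW hm) (pair_notMem hw h), fun hm => absurd hm zero_ne_one⟩

omit [Finite V] in
-- The part of `W` outside `H` is `w + x + (W ∩ H)`, a translate of `W ∩ H` in the second copy; the
-- part in `H` has been replaced by its polar.
theorem extendedWord_polarity (hw : w ∉ H) (hH : ∀ v, v ∈ H ∨ v - w ∈ H)
    {W : Submodule (ZMod 2) V} {x : H} (hx : w + x ∈ W) :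
    extendedWord ((projPoints W \ projPoints H) ∪
        projPoints ((π (W.submoduleOf H)).map H.subtype)) =
      Sum.elim (flat (π (W.submoduleOf H)) 0) (flat (W.submoduleOf H) x) ∘ pointEquiv hw hH := by
  refine extendedWord_eq hw hH (flat_zero_apply_eq_one.2 (Submodule.zero_mem _)) ?_
  rintro p (h | h) hp
  · rw [Set.mem_union, Set.mem_sdiff, mem_projPoints, mem_projPoints, mem_projPoints, hp,
      Sum.elim_inl, flat_zero_apply_eq_one]
    have hh : vectorOfPair H w (Sum.inl h) = h := rfl
    rw [hh]
    constructor
    · rintro (⟨_, hn⟩ | ⟨u, hu, he⟩)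
      · exact absurd h.2 hn
      · rwa [← Subtype.ext he]
    · exact fun hu => Or.inr ⟨h, hu, rfl⟩
  · rw [Set.mem_union, Set.mem_sdiff, mem_projPoints, mem_projPoints, mem_projPoints, hp,
      Sum.elim_inr, flat_apply_eq_one]
    have hh : vectorOfPair H w (Sum.inr h) = w + h := rfl
    have hiff : w + (h : V) ∈ W ↔ h - x ∈ W.submoduleOf H := by
      have e : w + (h : V) = (w + x) + ((h - x : H) : V) := by
        rw [Submodule.coe_sub]; abel
      rw [e, Submodule.add_mem_iff_right _ hx]
      rfl
    rw [hh, ← hiff]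
    constructor
    · rintro (⟨hm, _⟩ | ⟨u, hu, he⟩)
      · exact hm
      · exact absurd (he ▸ u.2 : w + (h : V) ∈ H) (pair_notMem hw h)
    · exact fun hm => Or.inl ⟨hm, pair_notMem hw h⟩

theorem finrank_submoduleOf_add_one (hH : ∀ v, v ∈ H ∨ v - w ∈ H) {W : Submodule (ZMod 2) V}
    {x : H} (hw : w ∉ H) (hx : w + x ∈ W) :
    finrank (ZMod 2) W = finrank (ZMod 2) (W.submoduleOf H) + 1 := by
  have hmap : (W.submoduleOf H).map H.subtype = H ⊓ W := Submodule.map_comap_subtype H W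
  have hx' : w + (x : V) ∉ H ⊓ W := fun h => pair_notMem hw x h.1
  have : W = (H ⊓ W) ⊔ Submodule.span (ZMod 2) {w + (x : V)} := by
    ext v
    rw [mem_sup_span_singleton]
    constructor
    · intro hv
      rcases hH v with h | h
      · exact Or.inl ⟨h, hv⟩
      · refine Or.inr ⟨?_, W.sub_mem hv hx⟩
        rw [← sub_sub]
        exact H.sub_mem h x.2
    · rintro (h | h)
      · exact h.2
      · have := W.add_mem h.2 hx
        rwa [sub_add_cancel] at this
  conv_lhs => rw [this]
  rw [finrank_sup_span_singleton hx', ← hmap, Submodule.finrank_map_subtype_eq]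

theorem image_extendedWord_polarityBlocks (hw : w ∉ H) (hH : ∀ v, v ∈ H ∨ v - w ∈ H) :
    extendedWord '' polarityBlocks 3 H π = (fun c => c ∘ pointEquiv hw hH) '' polarityGenerators π := by
  ext z
  constructor
  · rintro ⟨_, ⟨W, hW, hWH, rfl⟩ | ⟨W, hW, hWH, rfl⟩, rfl⟩
    · refine ⟨_, Or.inl ⟨W.submoduleOf H, ?_, rfl⟩, (extendedWord_subspace hw hH hWH).symm⟩
      rw [(Submodule.submoduleOfEquivOfLe hWH).finrank_eq, hW]
    · obtain ⟨v, hv, hvH⟩ := SetLike.not_le_iff_exists.1 hWH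
      have hx := (hH v).resolve_left hvH
      have hxW : w + ((⟨v - w, hx⟩ : H) : V) ∈ W := by
        rwa [show w + ((⟨v - w, hx⟩ : H) : V) = v from add_sub_cancel w v]
      have hdim := finrank_submoduleOf_add_one hH hw hxW
      exact ⟨_, Or.inr ⟨W.submoduleOf H, ⟨v - w, hx⟩, by omega, rfl⟩,
        (extendedWord_polarity hw hH hxW).symm⟩
  · rintro ⟨_, ⟨W, hW, rfl⟩ | ⟨U, x, hU, rfl⟩, rfl⟩
    · have hof : (W.map H.subtype).submoduleOf H = W :=
        Submodule.comap_map_eq_of_injective H.injective_subtype W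
      have hle : W.map H.subtype ≤ H := Submodule.map_subtype_le H W
      refine ⟨_, Or.inl ⟨W.map H.subtype, ?_, hle, rfl⟩, ?_⟩
      · rw [Submodule.finrank_map_subtype_eq, hW]
      · rw [extendedWord_subspace hw hH hle, hof]
    -- The generator given by `U` and `x` comes from the 4-space spanned by `U` and the vector `w +
    -- x` outside `H`.
    · set W := U.map H.subtype ⊔ Submodule.span (ZMod 2) {w + (x : V)} with hWdef
      have hxW : w + (x : V) ∈ W := Submodule.mem_sup_right (Submodule.mem_span_singleton_self _)
      have hof : W.submoduleOf H = U := by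
        ext u
        have h1 : u ∈ W.submoduleOf H ↔ (u : V) ∈ W := Iff.rfl
        rw [h1, hWdef, mem_sup_span_singleton]
        constructor
        · rintro (⟨u', hu', he⟩ | h)
          · rwa [← Subtype.ext he]
          · have h2 := Submodule.map_subtype_le H U h
            exact absurd ((Submodule.sub_mem_iff_right _ u.2).1 h2) (pair_notMem hw x)
        · exact fun hu => Or.inl ⟨u, hu, rfl⟩
      have hdim := finrank_submoduleOf_add_one hH hw hxW
      rw [hof, hU] at hdim
      refine ⟨_, Or.inr ⟨W, hdim, fun hle => pair_notMem hw x (hle hxW), rfl⟩, ?_⟩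
      rw [extendedWord_polarity hw hH hxW, hof]

end Blocks

/-! ### The polarity design and its extended code -/

section Main

open Module

theorem theorem1
    (H : Submodule (ZMod 2) (Fin 7 → ZMod 2)) (hH : Module.finrank (ZMod 2) H = 6)
    (π : Submodule (ZMod 2) H → Submodule (ZMod 2) H) (hπ : IsPolarity π) :
    IsTwoDesign (polarityBlocks 3 H π) 127 15 155 ∧
    HasParameters (extendedCode (blockCode (polarityBlocks 3 H π))) 128 64 16 ∧
    IsSelfDual (extendedCode (blockCode (polarityBlocks 3 H π))) ∧
    IsDoublyEven (extendedCode (blockCode (polarityBlocks 3 H π))) ∧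
    (∀ i : ℕ, weightDistribution (extendedCode (blockCode (polarityBlocks 3 H π))) i =
      weightDistribution (reedMuller 3 7) i) ∧
    weightDistribution (extendedCode (blockCode (polarityBlocks 3 H π))) 16 = 94488 ∧
    weightDistribution (extendedCode (blockCode (polarityBlocks 3 H π))) 20 = 0 := by
  classical
  have hV := finrank_binary_seven
  obtain ⟨w, -, hw, hcov⟩ := exists_of_finrank_succ (U := H) (U' := ⊤) le_top
    (by rw [finrank_top, hV, hH])
  replace hcov : ∀ v, v ∈ H ∨ v - w ∈ H := fun v => hcov v trivial
  set e := pointEquiv hw hcov with he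
  have himg := image_extendedWord_polarityBlocks (π := π) hw hcov
  have hblock : ∀ B ∈ polarityBlocks 3 H π,
      ∃ c ∈ polarityGenerators π, c ∘ e = extendedWord B := fun B hB => by
    have : extendedWord B ∈ extendedWord '' polarityBlocks 3 H π := ⟨B, hB, rfl⟩
    rwa [himg] at this
  have hnorm : ∀ B ∈ polarityBlocks 3 H π, hammingNorm (extendedWord B) = 16 := fun B hB => by
    obtain ⟨c, hc, h⟩ := hblock B hB
    rw [← h, hammingNorm_comp_equiv, hammingNorm_generator hπ hH hc]
  have hcode : extendedCode (blockCode (polarityBlocks 3 H π)) = reindexCode e (polarityCode π) := by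
    rw [extendedCode_blockCode, himg, reindexCode, polarityCode, Submodule.map_span]
    · rfl
    · intro B hB
      rw [← cast_hammingNorm, hnorm B hB]
      rfl
  have hcard : Fintype.card (Option (ℙ (ZMod 2) (Fin 7 → ZMod 2))) = 128 := by
    rw [Fintype.card_congr e, card_sum_self hH]
  have hsd := (polarityCode_isSelfDual hπ hH).reindexCode e
  have hde := (polarityCode_isDoublyEven hπ hH).reindexCode e
  have hmin : ∀ c ∈ polarityCode π, c ≠ 0 → 16 ≤ hammingNorm c :=
    fun c hc => le_hammingNorm_polarityCode hπ hH hc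
  have h16 := weightDistribution_polarityCode_sixteen hπ hH
  rw [hcode]
  refine ⟨⟨?_, ?_, ?_⟩, ?_, hsd, hde, ?_, ?_, ?_⟩
  · have : Fintype.card (ℙ (ZMod 2) (Fin 7 → ZMod 2)) + 1 = 128 := by
      rw [← hcard, Fintype.card_option]
    rw [Nat.card_eq_fintype_card]
    omega
  · intro B hB
    have := hnorm B hB
    rw [hammingNorm_extendedWord] at this
    omega
  · intro p q hpq
    have hnone : ∀ p : ℙ (ZMod 2) (Fin 7 → ZMod 2), e (some p) ≠ Sum.inl 0 := fun p h => by
      rw [← pointEquiv_none hw hcov] at h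
      exact absurd (e.injective h) (by simp)
    rw [← ncard_generators_pair hπ hH (s := e (some p)) (t := e (some q))
      (fun h => hpq (Option.some_injective _ (e.injective h))) (hnone p) (hnone q)]
    refine Set.ncard_congr (fun B _ => extendedWord B ∘ e.symm) ?_ ?_ ?_
    · rintro B ⟨hB, hp, hq⟩
      obtain ⟨c, hc, h⟩ := hblock B hB
      have hce : extendedWord B ∘ e.symm = c := by rw [← h]; funext k; simp
      refine ⟨by rwa [hce], ?_, ?_⟩
      · simpa using extendedWord_some_eq_one.2 hp
      · simpa using extendedWord_some_eq_one.2 hq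
    · intro B B' _ _ h
      exact extendedWord_injective (e.symm.surjective.injective_comp_right h)
    · rintro c ⟨hc, h1, h2⟩
      have : c ∘ e ∈ extendedWord '' polarityBlocks 3 H π := by
        rw [himg]
        exact ⟨c, hc, rfl⟩
      obtain ⟨B, hB, h⟩ := this
      refine ⟨B, ⟨hB, ?_, ?_⟩, ?_⟩
      · rw [← extendedWord_some_eq_one, h]
        exact h1
      · rw [← extendedWord_some_eq_one, h]
        exact h2
      · rw [h]; funext k; simp
  · refine hasParameters_of_hammingNorm hcard ?_ ?_ ?_
    · have := finrank_of_isSelfDual hsd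
      omega
    · intro c hc h0
      have h1 := hmin _ (mem_reindexCode.1 hc) (fun h => h0 (by
        have : (c ∘ e.symm) ∘ e = 0 := by rw [h]; rfl
        rw [← this]; funext k; simp))
      rwa [hammingNorm_comp_equiv] at h1
    -- The minimum distance is attained because the number of words of weight 16 is nonzero.
    · have hne : {c | c ∈ reindexCode e (polarityCode π) ∧ hammingNorm c = 16}.Nonempty := by
        apply Set.nonempty_of_ncard_ne_zero
        have : weightDistribution (reindexCode e (polarityCode π)) 16 ≠ 0 := by
          rw [weightDistribution_reindexCode, h16]
          norm_num
        exact this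
      obtain ⟨c, hc, hw16⟩ := hne
      exact ⟨c, hc, by rw [← hammingNorm_pos_iff, hw16]; norm_num, hw16⟩
  · intro i
    rw [weightDistribution_reindexCode]
    exact weightDistribution_eq_of_sixteen (card_sum_self hH) card_binary_seven
      (polarityCode_isSelfDual hπ hH) reedMuller_isSelfDual (polarityCode_isDoublyEven hπ hH)
      reedMuller_isDoublyEven hmin (fun c => le_hammingNorm_reedMuller)
      (fun c hc => hammingNorm_ne_twenty_polarityCode hπ hH hc)
      (fun c => hammingNorm_ne_twenty_reedMuller)
      (h16.trans weightDistribution_reedMuller_sixteen.symm) i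
  · rw [weightDistribution_reindexCode, h16]
  · rw [weightDistribution_reindexCode]
    exact weightDistribution_eq_zero fun c hc => hammingNorm_ne_twenty_polarityCode hπ hH hc

end Main
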